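/- Let $p$ be a prime, $K$ a finite extension of $\mathbb{Q}_p$ with the valuation $v_p$ extending the $p$-adic one, and $\mathcal{O}_K$ its ring of integers. **The equation.** Let $n,g\ge 1$ be integers and $N>0$ real (for instance $N\in\frac1e\mathbb{Z}_{>0}$, with $e$ the ramification index). Let $\mathrm{f}=(f_{ij})\in M_g(\mathcal{O}_K[[t]])$, $G\in\mathcal{O}_K[[t]]^g$, and for $x\in(tK[[t]])^g$ put $H_{\mathrm f}(x)=\big(f_{ij}(x_j)\big)_{i,j}$. Assume that $H_{\mathrm f}(0)$ is invertible in $M_g(\mathcal{O}_K)$ and that the solution $X\in(tK[[t]])^g$ of $H_{\mathrm f}(X)\cdot X'=G$ has coefficients in $\mathcal{O}_K$. Put $$M=\lfloor\log_p n\rfloor+\begin{cases}\max(N,3)&p=2,\\ \max(N,2)&p=3,\\ N&p\ge5.\end{cases}$$ **Fixed-point arithmetic at precision $O(p^M)$.** Numbers are elements of $\mathcal{O}_K/p^M:=\mathcal{O}_K/\{v_p\ge M\}$, with its addition, subtraction and multiplication. The division of $x$ by $y$ raises an error if $v_p(y)>v_p(x)$, returns $0$ if $x=0$, and otherwise returns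 an arbitrary $z$ with $x=yz$. Each of these operations counts as one. **Algorithm DiffSolve.** It uses a routine that multiplies $g\times g$ matrices of polynomials of degree at most $d$ in at most $\mathrm{MM}(g,d)$ operations, a routine that computes $H_{\mathrm f}(x)\bmod t^d$ in at most $\mathrm{C}(d)$ operations, and a routine that inverts invertible $g\times g$ matrices of numbers in at most $\mathrm{I}(g)$ operations; all three are correct and free of errors over $\mathcal{O}_K/p^M$. For $n=0$ it returns $(0,\,H_{\mathrm f}(0)^{-1})$. For $n\ge1$ it puts $m=\lceil\frac{n-1}2\rceil$, computes $(X_m,H_m)$ by a recursive call with $m$ in place of $n$, and returns $(X_n,H_n)$ with $$H_n=2H_m-H_m\,H_{\mathrm f}(X_m)\,H_m\bmod t^{m+1},\qquad X_n=X_m+H_n\int\big(G-H_{\mathrm f}(X_m)X_m'\big)\,dt\bmod t^{n+1},$$ where $\int$ is the primitive without constant term, computed by dividing the coefficient of $t^{k}$ by $k+1$. **Theorem.** There is an absolute constant $c$ such that the following holds for all data as above. 1. For every $M>0$ and every $g$, Gauss–Jordan elimination with pivots of minimal valuation is a correct, error-free inversion routine over $\mathcal{O}_K/p^M$, with at most $c\,g^3$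 operations. 2. Whatever values the divisions return, DiffSolve, run in fixed-point arithmetic at precision $O(p^M)$, never raises an error (all computations are done in $\mathcal{O}_K$), and its output is correct at precision $O(p^N)$: $X_n\equiv X\bmod(p^N,t^{n+1})$, and $H_n$ is the inverse of $H_{\mathrm f}(X)$ modulo $(p^N,t^{\lfloor n/2\rfloor+1})$. 3. Suppose that $\mathrm{MM}(g,\cdot)$ and $\mathrm C$ are superadditive on positive integers, and that $\mathrm{MM}(g,\cdot)$ is nondecreasing with $\mathrm{MM}(g,d)\ge g^2(d+1)$. Then DiffSolve performs at most $$c\,\big(\mathrm{MM}(g,n)+\mathrm C(n)\big)+\mathrm I(g)$$ operations. Consequently the cost is $\tilde O(g^\omega n)$, uniformly in $g$ and $n$, whenever the routines have exponent $\omega$. Precisely, suppose that $A\ge0$ and $k\in\mathbb{N}$ are such that for all integers $a,b\ge1$ $$\mathrm{MM}(a,b)\le A\,a^\omega\,\mathrm{MM}(1,b),\qquad \mathrm{MM}(1,b)\le A\,b\,(1+\log b)^k,$$ $$\mathrm C(b)\le A\,g^\omega b\,(1+\log(gb))^k,\qquad \mathrm I(a)\le A\,a^\omega(1+\log a)^k.$$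 Then the cost is at most $c\,(1+A)^2\,g^\omega n\,(1+\log(gn))^k$. -/

import Mathlib

universe u

open scoped PowerSeries

/-! ### Fixed-point arithmetic -/

/-- The ring of integers of a field with a nonarchimedean absolute value. -/
def ringOfInt (K : Type*) [NormedField K] [IsUltrametricDist K] : Subring K where
  carrier := {x | ‖x‖ ≤ 1}
  zero_mem' := by simp
  one_mem' := by simp
  add_mem' := fun {a b} ha hb =>
    (IsUltrametricDist.norm_add_le_max a b).trans (max_le ha hb)
  neg_mem' := fun {a} ha => by simpa using ha
  mul_mem' := fun {a b} ha hb => by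
    simpa using mul_le_one₀ ha (norm_nonneg b) hb

/-- The ideal `p ^ M` of the ring of integers, for a real exponent `M`: the elements of
`p`-adic valuation at least `M`, that is, of absolute value at most `p ^ (-M)`. If `e` is the
ramification index, `π` a uniformizer and `e * M` an integer, this is the ideal generated by
`π ^ (e * M)`. -/
def precisionIdeal (p : ℕ) [Fact p.Prime] (K : Type*) [NormedField K] [IsUltrametricDist K]
    (M : ℝ) : Ideal (ringOfInt K) where
  carrier := {x | ‖(x : K)‖ ≤ (p : ℝ) ^ (-M)}
  zero_mem' := by
    have : (0 : ℝ) ≤ (p : ℝ) ^ (-M) := by positivity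
    simpa using this
  add_mem' := fun {a b} ha hb =>
    (IsUltrametricDist.norm_add_le_max (a : K) (b : K)).trans (max_le ha hb)
  smul_mem' := fun c {x} hx => by
    have h1 : ‖(c : K)‖ ≤ 1 := c.2
    have h2 : ‖(x : K)‖ ≤ (p : ℝ) ^ (-M) := hx
    simpa using (mul_le_of_le_one_left (norm_nonneg (x : K)) h1).trans h2

/-- The numbers `a + O(p ^ M)` of fixed-point arithmetic at precision `O(p ^ M)`. -/
abbrev FixedPoint (p : ℕ) [Fact p.Prime] (K : Type*) [NormedField K] [IsUltrametricDist K]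
    (M : ℝ) : Type _ :=
  ringOfInt K ⧸ precisionIdeal p K M

/-- Reduction modulo `p ^ M`. -/
abbrev reduceMod (p : ℕ) [Fact p.Prime] (K : Type*) [NormedField K] [IsUltrametricDist K]
    (M : ℝ) : ringOfInt K →+* FixedPoint p K M :=
  Ideal.Quotient.mk (precisionIdeal p K M)

/-- Divisibility of fixed-point numbers is the comparison of valuations, where the class of `0`
has valuation `∞`. -/
theorem reduceMod_dvd_iff (p : ℕ) [Fact p.Prime] (K : Type*) [NormedField K]
    [IsUltrametricDist K] (M : ℝ) (x y : ringOfInt K) :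
    reduceMod p K M y ∣ reduceMod p K M x ↔
      reduceMod p K M x = 0 ∨ ‖(x : K)‖ ≤ ‖(y : K)‖ := by
  constructor
  · rintro ⟨z, hz⟩
    obtain ⟨z, rfl⟩ := Ideal.Quotient.mk_surjective z
    by_contra! h
    obtain ⟨h0, hlt⟩ := h
    rw [← map_mul, Ideal.Quotient.mk_eq_mk_iff_sub_mem] at hz
    apply h0
    rw [Ideal.Quotient.eq_zero_iff_mem]
    have hyz : ‖(y : K) * z‖ < ‖(x : K)‖ := by
      rw [norm_mul]
      exact (mul_le_of_le_one_right (norm_nonneg _) z.2).trans_lt hlt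
    have h1 : ‖(x : K) - y * z‖ ≤ (p : ℝ) ^ (-M) := hz
    have h2 : ‖(x : K)‖ ≤ max ‖(x : K) - y * z‖ ‖(y : K) * z‖ := by
      simpa using IsUltrametricDist.norm_add_le_max ((x : K) - y * z) (y * z)
    rcases le_max_iff.1 h2 with h3 | h3
    · exact h3.trans h1
    · exact absurd hyz (not_lt.2 h3)
  · rintro (h | h)
    · rw [h]; exact dvd_zero _
    · apply map_dvd
      by_cases hy : (y : K) = 0
      · have hx : x = 0 := by
          apply Subtype.ext
          simpa [hy] using h
        rw [hx]; exact dvd_zero _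
      · refine ⟨⟨(x : K) / y, ?_⟩, ?_⟩
        · change ‖(x : K) / y‖ ≤ 1
          rw [norm_div]
          exact div_le_one_of_le₀ h (norm_nonneg _)
        · apply Subtype.ext
          change (x : K) = y * (x / y)
          field_simp

/-! ### Programs over a ring, with a count of the arithmetic operations -/

/-- The arithmetic operations. -/
inductive ArithOp : Type
  | add
  | sub
  | mul
  | div

/-- The operation does not raise an error: only a division can, and it does so exactly if no
quotient exists (over `FixedPoint p K M`: if the valuation of `y` exceeds that of `x`). -/
def ArithOp.Defined {R : Type*} [CommRing R] (x y : R) : ArithOp → Prop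
  | .add => True
  | .sub => True
  | .mul => True
  | .div => y ∣ x

/-- `z` is a possible result of the operation on `x` and `y`. A division `0 / y` returns `0`;
any other division may return an arbitrary quotient. -/
def ArithOp.Result {R : Type*} [CommRing R] (x y z : R) : ArithOp → Prop
  | .add => z = x + y
  | .sub => z = x - y
  | .mul => z = x * y
  | .div => (x = 0 ∧ z = 0) ∨ (x ≠ 0 ∧ x = y * z)

/-- A program over `R`: it either returns a value or performs one arithmetic operation and
continues with the result of this operation. -/
inductive Comp (R : Type u) (α : Type u) : Type u
  | ret (a : α) : Comp R α
  | step (op : ArithOp) (x y : R) (next : R → Comp R α) : Comp R α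

namespace Comp

/-- Sequential composition. -/
def bind {R α β : Type u} : Comp R α → (α → Comp R β) → Comp R β
  | ret a, F => F a
  | step op x y next, F => step op x y (fun z => bind (next z) F)

instance (R : Type u) : Monad (Comp R) where
  pure := Comp.ret
  bind := Comp.bind

/-- Every execution of the program is free of errors and returns, after some number `c` of
arithmetic operations, a value `a` such that `P a c` holds. -/
def Ensures {R α : Type u} [CommRing R] : Comp R α → (α → ℕ → Prop) → Prop
  | ret a, P => P a 0
  | step op x y next, P =>
      op.Defined x y ∧ ∀ z, op.Result x y z → Ensures (next z) (fun a c => P a (c + 1))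

/-- A single operation. -/
def op {R : Type u} (o : ArithOp) (x y : R) : Comp R R := step o x y ret

/-- Run a family of programs one after the other and collect the results. -/
def tabulate {R α : Type u} : (n : ℕ) → (Fin n → Comp R α) → Comp R (Fin n → α)
  | 0, _ => pure Fin.elim0
  | n + 1, F => do
      let a ← F 0
      let v ← tabulate n (fun i => F i.succ)
      pure (Fin.cons a v)

end Comp

/-! ### Truncated power series, given by their coefficients -/

/-- The `k`-th coefficient, zero beyond the length. -/
def coeffAt {R : Type u} [Zero R] {n : ℕ} (a : Fin n → R) (k : ℕ) : R :=
  if h : k < n then a ⟨k, h⟩ else 0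

/-- Truncate, or pad with zeros, to length `l`. -/
def resize {R : Type u} [Zero R] {n : ℕ} (l : ℕ) (a : Fin n → R) : Fin l → R :=
  fun k => coeffAt a k

/-- The polynomial with the given coefficients, as a power series. -/
def toSeries {R : Type u} [CommRing R] {n : ℕ} (a : Fin n → R) : R⟦X⟧ :=
  PowerSeries.mk (coeffAt a)

/-- Vectors of length `g` of series given by `n` coefficients. -/
abbrev TVec (R : Type u) (g n : ℕ) : Type u := Fin g → Fin n → R

/-- `g × g` matrices of series given by `n` coefficients. -/
abbrev TMat (R : Type u) (g n : ℕ) : Type u := Fin g → Fin g → Fin n → R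

/-! ### The differential equation -/

/-- The map `H_f : (x_1, …, x_g) ↦ (f_ij(x_j))`, for `x_j` without constant term. -/
noncomputable def Hmap {A : Type u} [CommRing A] {g : ℕ}
    (f : Matrix (Fin g) (Fin g) A⟦X⟧) (x : Fin g → A⟦X⟧) : Matrix (Fin g) (Fin g) A⟦X⟧ :=
  Matrix.of fun i j => PowerSeries.subst (x j) (f i j)

/-- `H_f(0)`. -/
noncomputable def Hzero {A : Type u} [CommRing A] {g : ℕ}
    (f : Matrix (Fin g) (Fin g) A⟦X⟧) : Matrix (Fin g) (Fin g) A :=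
  f.map PowerSeries.constantCoeff

/-- `x` has no constant term and `H_f(x) · x' = G`. -/
def IsSolution {A : Type u} [CommRing A] {g : ℕ} (f : Matrix (Fin g) (Fin g) A⟦X⟧)
    (G x : Fin g → A⟦X⟧) : Prop :=
  (∀ j, PowerSeries.constantCoeff (x j) = 0) ∧
    (Hmap f x).mulVec (fun j => PowerSeries.derivative A (x j)) = G

/-! ### Gauss-Jordan inversion -/

open Classical in
/-- A row `r ≥ k` whose entry in column `k` has minimal valuation, that is, divides the
others. -/
noncomputable def pivotRow {R : Type u} [CommRing R] {g : ℕ} (A : Matrix (Fin g) (Fin g) R)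
    (k : Fin g) : Fin g :=
  if h : ∃ r, k ≤ r ∧ ∀ i, k ≤ i → A r k ∣ A i k then h.choose else k

/-- One step: move the pivot row to row `k`, divide it by the pivot, and clear the rest of
column `k`. The operations are applied to both matrices. -/
noncomputable def gaussStep {R : Type u} [CommRing R] {g : ℕ}
    (S : Matrix (Fin g) (Fin g) R × Matrix (Fin g) (Fin g) R) (k : Fin g) :
    Comp R (Matrix (Fin g) (Fin g) R × Matrix (Fin g) (Fin g) R) := do
  let s := Equiv.swap k (pivotRow S.1 k)
  let A : Matrix (Fin g) (Fin g) R := fun i j => S.1 (s i) j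
  let B : Matrix (Fin g) (Fin g) R := fun i j => S.2 (s i) j
  let a ← Comp.tabulate g fun j => Comp.op .div (A k j) (A k k)
  let b ← Comp.tabulate g fun j => Comp.op .div (B k j) (A k k)
  let A' ← Comp.tabulate g fun i => Comp.tabulate g fun j =>
    if i = k then pure (a j) else do
      let u ← Comp.op .mul (A i k) (a j)
      Comp.op .sub (A i j) u
  let B' ← Comp.tabulate g fun i => Comp.tabulate g fun j =>
    if i = k then pure (b j) else do
      let u ← Comp.op .mul (A i k) (b j)
      Comp.op .sub (B i j) u
  pure (A', B')

/-- Inversion of a matrix by Gauss-Jordan elimination. -/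
noncomputable def gaussJordan {R : Type u} [CommRing R] {g : ℕ} (A : Matrix (Fin g) (Fin g) R) :
    Comp R (Matrix (Fin g) (Fin g) R) := do
  let S ← (List.finRange g).foldlM gaussStep (A, (1 : Matrix (Fin g) (Fin g) R))
  pure S.2

/-- The program `inv` inverts every invertible `g × g` matrix, without errors, in at most `I`
operations. -/
def IsInversion {R : Type u} [CommRing R] {g : ℕ}
    (inv : Matrix (Fin g) (Fin g) R → Comp R (Matrix (Fin g) (Fin g) R)) (I : ℕ) : Prop :=
  ∀ A : Matrix (Fin g) (Fin g) R, IsUnit A →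
    (inv A).Ensures fun B c => A * B = 1 ∧ B * A = 1 ∧ c ≤ I

/-! ### The algorithm -/

/-- The programs for the basic tasks: multiplication of matrices of polynomials of degree at
most `d`, evaluation of `H_f` modulo `t ^ n`, inversion of matrices of scalars. -/
structure Routines (R : Type u) (g : ℕ) : Type u where
  matMul : (d : ℕ) → TMat R g (d + 1) → TMat R g (d + 1) → Comp R (TMat R g (2 * d + 1))
  evalH : (n : ℕ) → TVec R g n → Comp R (TMat R g n)
  inv : Matrix (Fin g) (Fin g) R → Comp R (Matrix (Fin g) (Fin g) R)

/-- The programs perform their tasks without errors, with at most `MM d`, `C n` and `I`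
arithmetic operations. -/
structure Routines.Correct {R : Type u} [CommRing R] {g : ℕ} (T : Routines R g)
    (f : Matrix (Fin g) (Fin g) R⟦X⟧) (MM C : ℕ → ℕ) (I : ℕ) : Prop where
  matMul : ∀ (d : ℕ) (A B : TMat R g (d + 1)), (T.matMul d A B).Ensures fun P c =>
    (∀ i j, toSeries (P i j) = ∑ l, toSeries (A i l) * toSeries (B l j)) ∧ c ≤ MM d
  evalH : ∀ (n : ℕ) (x : TVec R g n),
    (∀ j, PowerSeries.constantCoeff (toSeries (x j)) = 0) →
    (T.evalH n x).Ensures fun F c =>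
      (∀ i j (k : Fin n),
        F i j k = PowerSeries.coeff (k : ℕ) (Hmap f (fun j => toSeries (x j)) i j)) ∧ c ≤ C n
  inv : IsInversion T.inv I

/-- Matrix-vector product modulo `t ^ n`, through the product with the matrix all of whose
columns are the given vector. -/
def mulVecMod {R : Type u} [CommRing R] {g : ℕ} (T : Routines R g) {a b : ℕ} (d n : ℕ)
    (A : TMat R g a) (v : TVec R g b) : Comp R (TVec R g n) := do
  let P ← T.matMul d (fun i j => resize (d + 1) (A i j)) (fun i _ => resize (d + 1) (v i))
  pure fun i => resize n (P i i)

/-- The algorithm `DiffSolve`. For input `n` it returns `n + 1` coefficients of the solution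
`X`, and the inverse of `H_f(X)` modulo `t ^ (m + 1)`, where `m = ⌊n / 2⌋`, which for `n ≥ 1` is
the rounded-up half of `n - 1`. -/
noncomputable def diffSolve {R : Type u} [CommRing R] {g : ℕ} (T : Routines R g)
    (f : Matrix (Fin g) (Fin g) R⟦X⟧) (G : Fin g → R⟦X⟧) (n : ℕ) :
    Comp R (TVec R g (n + 1) × TMat R g (n / 2 + 1)) :=
  if _hn : n = 0 then do
    let B ← T.inv (Hzero f)
    pure (fun _ _ => 0, fun i j => resize (n / 2 + 1) (fun _ : Fin 1 => B i j))
  else do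
    let m := n / 2
    let (x, h) ← diffSolve T f G m
    let F ← T.evalH n (fun j => resize n (x j))
    -- the next value of the inverse: 2 h - h * F * h modulo t ^ (m + 1)
    let P ← T.matMul m (fun i j => resize (m + 1) (h i j)) (fun i j => resize (m + 1) (F i j))
    let Q ← T.matMul m (fun i j => resize (m + 1) (P i j)) (fun i j => resize (m + 1) (h i j))
    let hNew : TMat R g (n / 2 + 1) ← Comp.tabulate g fun i => Comp.tabulate g fun j =>
      Comp.tabulate (n / 2 + 1) fun k => do
        let u ← Comp.op .mul (2 : R) (coeffAt (h i j) k)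
        Comp.op .sub u (coeffAt (Q i j) k)
    -- the residual G - F * x' modulo t ^ n
    let dx : TVec R g m ← Comp.tabulate g fun i => Comp.tabulate m fun k =>
      Comp.op .mul ((k : ℕ) + 1 : R) (coeffAt (x i) ((k : ℕ) + 1))
    let V ← mulVecMod T n n F dx
    let E : TVec R g n ← Comp.tabulate g fun i => Comp.tabulate n fun k =>
      Comp.op .sub (PowerSeries.coeff (k : ℕ) (G i)) (V i k)
    -- its primitive: the coefficient of t ^ (k + 1) is a quotient by k + 1
    let J : TVec R g n ← Comp.tabulate g fun i => Comp.tabulate n fun k =>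
      Comp.op .div (E i k) ((k : ℕ) + 1 : R)
    let primitive : TVec R g (n + 1) := fun i => Fin.cons (0 : R) (J i)
    let W ← mulVecMod T n (n + 1) hNew primitive
    let xNew : TVec R g (n + 1) ← Comp.tabulate g fun i => Comp.tabulate (n + 1) fun k =>
      Comp.op .add (coeffAt (x i) k) (W i k)
    pure (xNew, hNew)
termination_by n
decreasing_by omega

/-! ### Precision and cost -/

/-- The working precision. -/
noncomputable def workingPrecision (p n : ℕ) (N : ℝ) : ℝ :=
  (if p = 2 then max N 3 else if p = 3 then max N 2 else N) + (Nat.log p n : ℝ)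

/-- The output `(x, h)` is correct at precision `O(p ^ N)`: `x` is `X` modulo `t ^ (n + 1)` and
`h` is the inverse of `H` modulo `t ^ (n / 2 + 1)`, up to elements of valuation at least `N`,
whatever representatives in the ring of integers are chosen. -/
def CorrectOutput (p : ℕ) [Fact p.Prime] {K : Type u} [NormedField K] [IsUltrametricDist K]
    {g n : ℕ} (M N : ℝ) (X : Fin g → K⟦X⟧) (H : Matrix (Fin g) (Fin g) K⟦X⟧)
    (out : TVec (FixedPoint p K M) g (n + 1) × TMat (FixedPoint p K M) g (n / 2 + 1)) : Prop :=
  (∀ (i : Fin g) (k : Fin (n + 1)) (a : ringOfInt K), reduceMod p K M a = out.1 i k →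
    ‖(a : K) - PowerSeries.coeff (k : ℕ) (X i)‖ ≤ (p : ℝ) ^ (-N)) ∧
  ∀ B : Matrix (Fin g) (Fin g) (ringOfInt K)⟦X⟧,
    (∀ i j (k : Fin (n / 2 + 1)),
      reduceMod p K M (PowerSeries.coeff (k : ℕ) (B i j)) = out.2 i j k) →
    ∀ i j (k : Fin (n / 2 + 1)),
      ‖PowerSeries.coeff (k : ℕ)
        ((B.map (PowerSeries.map (ringOfInt K).subtype) * H - 1) i j)‖ ≤ (p : ℝ) ^ (-N)

/-- The usual assumptions on the cost `MM d` of multiplying `g × g` matrices of polynomials of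
degree at most `d` and the cost `C n` of evaluating `H_f` modulo `t ^ n`: superadditivity,
products of smaller degree are not more expensive, and a product costs at least one operation per
coefficient of a factor. -/
structure CostAssumptions (g : ℕ) (MM C : ℕ → ℕ) : Prop where
  superadd_MM : ∀ a b, 1 ≤ a → 1 ≤ b → MM a + MM b ≤ MM (a + b)
  superadd_C : ∀ a b, 1 ≤ a → 1 ≤ b → C a + C b ≤ C (a + b)
  monotone_MM : Monotone MM
  size_le_MM : ∀ d, g ^ 2 * (d + 1) ≤ MM d

/-! Precision. Write U = H_f(X), and let δ = x - X be the error of a lift to O_K of the value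
computed at ⌊n/2⌋. Errors are measured by the ideals `errIdeal`, which allow a loss of ⌊log_p d⌋
digits in degree d. The point is that this loss does not accumulate along the recursion.

Since f_ij is evaluated at x_j alone, f_ij(x_j) x_j' is an exact derivative. Expanding around X, the
residual G - H_f(x) x' is the derivative of -Uδ plus terms that are integral multiples of δ^k / k
with k ≥ 2. These have integral coefficients and lie in the error ideal again: among k indices with
sum d, the smallest index l satisfies k l ≤ d, so v_p(k) + ⌊log_p l⌋ ≤ ⌊log_p d⌋, and the factor k
is paid for by the drop from degree d to degree l (`norm_coeff_pow_le`, `exists_congrUpTo_pow`).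
Hence the residual is (q - Uδ)' up to degree n - 1, with q integral and in the error ideal
(`IsSolution.exists_congrUpTo_residual`). So its coefficient of t^k is a multiple of k + 1 and no
division fails. Any quotient modulo p^M determines the coefficient of q - Uδ up to a loss of v_p(k +
1) ≤ ⌊log_p (k + 1)⌋ digits, which the error ideal absorbs.

The rest is Newton iteration: a product of two errors controlled up to degree m is controlled up to
degree 2m + 1 (`mul_mem_errIdeal`), which handles the approximate inverse and the update of x
(`NewtonStep.approxSolution`). The final loss is at most ⌊log_p n⌋ digits, and M - ⌊log_p n⌋ ≥ N.

Elimination. O_K / p^M is a local ring, so an invertible matrix always offers a unit pivot, and an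
entry dividing a unit is a unit (`pivotRow_spec`).

Cost. Superadditivity makes the costs of the successive halvings a geometric sum, while inversion
occurs only once, at n = 0 (`CostAssumptions.diffSolveCost_le`). -/

namespace Comp

/-! ### Rules for proving properties of all executions of a program -/

theorem Ensures.mono {R α : Type u} [CommRing R] {m : Comp R α} {P Q : α → ℕ → Prop}
    (h : m.Ensures P) (hPQ : ∀ a c, P a c → Q a c) : m.Ensures Q := by
  induction m generalizing P Q with
  | ret a => exact hPQ a 0 h
  | step op x y next ih =>
    exact ⟨h.1, fun z hz => ih z (h.2 z hz) fun a c => hPQ a (c + 1)⟩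

theorem ensures_pure {R α : Type u} [CommRing R] {a : α} {P : α → ℕ → Prop} (h : P a 0) :
    (pure a : Comp R α).Ensures P := h

theorem Ensures.bind {R α β : Type u} [CommRing R] {m : Comp R α} {F : α → Comp R β}
    {Q : α → ℕ → Prop} {P : β → ℕ → Prop} (h : m.Ensures Q)
    (hF : ∀ a c, Q a c → (F a).Ensures fun b c' => P b (c + c')) : (m >>= F).Ensures P := by
  change (Comp.bind m F).Ensures P
  induction m generalizing P Q with
  | ret a => simpa [Comp.bind] using hF a 0 h
  | step op x y next ih =>
    refine ⟨h.1, fun z hz => ih z (h.2 z hz) fun a c hac => ?_⟩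
    exact (hF a (c + 1) hac).mono fun b c' hb => by
      rwa [add_right_comm] at hb

theorem ensures_op {R : Type u} [CommRing R] {o : ArithOp} {x y : R} {P : R → ℕ → Prop}
    (hd : o.Defined x y) (h : ∀ z, o.Result x y z → P z 1) : (op o x y).Ensures P :=
  ⟨hd, fun z hz => by simpa [Ensures] using h z hz⟩

theorem ensures_add {R : Type u} [CommRing R] (x y : R) :
    (op .add x y).Ensures fun z c => z = x + y ∧ c ≤ 1 :=
  ensures_op trivial fun _ hz => ⟨hz, le_rfl⟩

theorem ensures_sub {R : Type u} [CommRing R] (x y : R) :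
    (op .sub x y).Ensures fun z c => z = x - y ∧ c ≤ 1 :=
  ensures_op trivial fun _ hz => ⟨hz, le_rfl⟩

theorem ensures_mul {R : Type u} [CommRing R] (x y : R) :
    (op .mul x y).Ensures fun z c => z = x * y ∧ c ≤ 1 :=
  ensures_op trivial fun _ hz => ⟨hz, le_rfl⟩

theorem ensures_div {R : Type u} [CommRing R] {x y : R} (h : y ∣ x) :
    (op .div x y).Ensures fun z c => y * z = x ∧ c ≤ 1 :=
  ensures_op h fun z hz => by
    refine ⟨?_, le_rfl⟩
    rcases hz with ⟨hx, hz⟩ | ⟨-, hz⟩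
    · rw [hx, hz, mul_zero]
    · exact hz.symm

theorem ensures_tabulate {R α : Type u} [CommRing R] {n b : ℕ} {F : Fin n → Comp R α}
    {Q : Fin n → α → Prop} (h : ∀ i, (F i).Ensures fun a c => Q i a ∧ c ≤ b) :
    (tabulate n F).Ensures fun v c => (∀ i, Q i (v i)) ∧ c ≤ n * b := by
  induction n with
  | zero => exact ensures_pure ⟨fun i => i.elim0, by simp⟩
  | succ n ih =>
    refine (h 0).bind fun a c ⟨ha, hc⟩ => (ih fun i => h i.succ).bind fun v c' ⟨hv, hc'⟩ => ?_
    refine ensures_pure ⟨Fin.cases ha hv, ?_⟩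
    rw [Nat.succ_mul]
    omega

theorem ensures_foldlM {R σ : Type u} {α : Type*} [CommRing R] {b : ℕ} (step : σ → α → Comp R σ)
    (Inv : List α → σ → Prop) (hstep : ∀ a l S, Inv (a :: l) S →
      (step S a).Ensures fun S' c => Inv l S' ∧ c ≤ b) (l : List α) (S : σ) (hS : Inv l S) :
    (l.foldlM step S).Ensures fun S' c => Inv [] S' ∧ c ≤ l.length * b := by
  induction l generalizing S with
  | nil => exact ensures_pure ⟨hS, by simp⟩
  | cons a l ih =>
    rw [List.foldlM_cons]
    refine (hstep a l S hS).bind fun S' c ⟨hS', hc⟩ => (ih S' hS').mono fun S'' c' ⟨h1, h2⟩ => ?_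
    refine ⟨h1, ?_⟩
    rw [List.length_cons, Nat.succ_mul]
    omega

end Comp

/-! ### Gauss–Jordan elimination over a local ring -/

/-- If all candidates were non-units, the diagonal entry 1 of C * A in position k would lie in the
maximal ideal. Divisibility then transfers the unit property to the chosen pivot. -/
theorem pivotRow_spec {R : Type u} [CommRing R] [IsLocalRing R] {g : ℕ}
    {A C : Matrix (Fin g) (Fin g) R} {k : Fin g} (hC : C * A = 1)
    (hA : ∀ j < k, ∀ i, A i j = (1 : Matrix (Fin g) (Fin g) R) i j) :
    k ≤ pivotRow A k ∧ IsUnit (A (pivotRow A k) k) := by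
  have hex : ∃ r, k ≤ r ∧ IsUnit (A r k) := by
    by_contra! h
    -- Columns j < k of A are already unit vectors, so row k of C * A = 1 reads off the entries C k
    -- j. Only the rows i ≥ k then contribute in column k.
    have hlow : ∀ j < k, C k j = 0 := fun j hj => by
      have h1 : (C * A) k j = C k j := by
        rw [Matrix.mul_apply, Finset.sum_eq_single j]
        · rw [hA j hj, Matrix.one_apply_eq, mul_one]
        · intro i _ hi
          rw [hA j hj, Matrix.one_apply_ne hi, mul_zero]
        · simp
      rw [← h1, hC, Matrix.one_apply_ne hj.ne']
    have h1 : (C * A) k k ∈ IsLocalRing.maximalIdeal R := by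
      rw [Matrix.mul_apply]
      refine Ideal.sum_mem _ fun i _ => ?_
      rcases lt_or_ge i k with hi | hi
      · rw [hlow i hi, zero_mul]
        exact Ideal.zero_mem _
      · exact Ideal.mul_mem_left _ _ (h i hi)
    rw [hC, Matrix.one_apply_eq] at h1
    exact h1 isUnit_one
  obtain ⟨r, hr, hu⟩ := hex
  have h : ∃ r, k ≤ r ∧ ∀ i, k ≤ i → A r k ∣ A i k := ⟨r, hr, fun i _ => hu.dvd⟩
  have hp : pivotRow A k = h.choose := dif_pos h
  rw [hp]
  exact ⟨h.choose_spec.1, isUnit_of_dvd_unit (h.choose_spec.2 r hr) hu⟩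

/-- The state `S` of the elimination of `A` when the columns in `l` remain to be cleared. -/
structure GaussInv {R : Type u} [CommRing R] {g : ℕ} (A : Matrix (Fin g) (Fin g) R)
    (l : List (Fin g)) (S : Matrix (Fin g) (Fin g) R × Matrix (Fin g) (Fin g) R) : Prop where
  sorted : l.Pairwise (· < ·)
  cleared_lt : ∀ j ∉ l, ∀ x ∈ l, j < x
  eq_mul : S.1 = S.2 * A
  leftInv : ∃ C, C * S.1 = 1
  cleared : ∀ j ∉ l, ∀ i, S.1 i j = (1 : Matrix (Fin g) (Fin g) R) i j

theorem ensures_rowOperation {R : Type u} [CommRing R] {g : ℕ} (A : Matrix (Fin g) (Fin g) R)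
    (k : Fin g) (c a : Fin g → R) :
    (Comp.tabulate g fun i => Comp.tabulate g fun j =>
      if i = k then pure (a j) else do
        let u ← Comp.op .mul (c i) (a j)
        Comp.op .sub (A i j) u).Ensures fun A' n =>
      (∀ i j, A' i j = if i = k then a j else A i j - c i * a j) ∧ n ≤ g * (g * 2) := by
  refine Comp.ensures_tabulate (Q := fun i (v : Fin g → R) => ∀ j, v j = if i = k then a j else
    A i j - c i * a j) fun i => ?_
  refine Comp.ensures_tabulate (Q := fun j z => z = if i = k then a j else
    A i j - c i * a j) fun j => ?_
  by_cases hi : i = k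
  · simp only [if_pos hi]
    exact Comp.ensures_pure ⟨rfl, by omega⟩
  · simp only [if_neg hi]
    refine (Comp.ensures_mul _ _).bind fun u n ⟨hu, hn⟩ =>
      (Comp.ensures_sub _ _).mono fun z n' ⟨hz, hn'⟩ => ⟨by rw [hz, hu], by omega⟩

theorem ensures_gaussStep {R : Type u} [CommRing R] [IsLocalRing R] {g : ℕ}
    {A : Matrix (Fin g) (Fin g) R} {k : Fin g} {l : List (Fin g)}
    {S : Matrix (Fin g) (Fin g) R × Matrix (Fin g) (Fin g) R} (hS : GaussInv A (k :: l) S) :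
    (gaussStep S k).Ensures fun S' c => GaussInv A l S' ∧ c ≤ 2 * g + 4 * g ^ 2 := by
  obtain ⟨hsort, hlt, heq, ⟨C, hC⟩, hcl⟩ := hS
  rw [List.pairwise_cons] at hsort
  have hcl' : ∀ j < k, ∀ i, S.1 i j = (1 : Matrix (Fin g) (Fin g) R) i j := fun j hj =>
    hcl j fun hmem => by
      rcases List.mem_cons.1 hmem with rfl | hmem
      · exact hj.false
      · exact (hj.trans (hsort.1 j hmem)).false
  obtain ⟨hr, hu⟩ := pivotRow_spec hC hcl'
  unfold gaussStep
  extract_lets s A₁ B₁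
  have hsk : s k = pivotRow S.1 k := Equiv.swap_apply_left _ _
  have hsj : ∀ j < k, s j = j := fun j hj =>
    Equiv.swap_apply_of_ne_of_ne hj.ne (hj.trans_le hr).ne
  have hpiv : IsUnit (A₁ k k) := by
    change IsUnit (S.1 (s k) k)
    rwa [hsk]
  refine (Comp.ensures_tabulate (Q := fun j z => A₁ k k * z = A₁ k j) fun j =>
    Comp.ensures_div hpiv.dvd).bind fun a c₁ ⟨ha, hc₁⟩ => ?_
  refine (Comp.ensures_tabulate (Q := fun j z => A₁ k k * z = B₁ k j) fun j =>
    Comp.ensures_div hpiv.dvd).bind fun b c₂ ⟨hb, hc₂⟩ => ?_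
  refine (ensures_rowOperation A₁ k (fun i => A₁ i k) a).bind fun A' c₃ ⟨hA', hc₃⟩ => ?_
  refine (ensures_rowOperation B₁ k (fun i => A₁ i k) b).bind fun B' c₄ ⟨hB', hc₄⟩ => ?_
  refine Comp.ensures_pure ⟨⟨hsort.2, ?_, ?_, ?_, ?_⟩, by nlinarith⟩
  · intro j hj x hx
    by_cases hjk : j = k
    · exact hjk ▸ hsort.1 x hx
    · exact hlt j (by simp [hjk, hj]) x (List.mem_cons_of_mem _ hx)
  · have h1 : ∀ i j, A₁ i j = ∑ t, B₁ i t * A t j := fun i j => by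
      change S.1 (s i) j = ∑ t, S.2 (s i) t * A t j
      rw [heq, Matrix.mul_apply]
    -- A unit pivot makes the quotients unique, so the relation can be checked after multiplication
    -- by the pivot.
    have h2 : ∀ j, a j = ∑ t, b t * A t j := fun j => by
      apply hpiv.mul_left_cancel
      rw [ha, h1, Finset.mul_sum]
      exact Finset.sum_congr rfl fun t _ => by rw [← hb, mul_assoc]
    ext i j
    rw [Matrix.mul_apply]
    dsimp only
    rw [hA']
    by_cases hi : i = k
    · simp only [hB', if_pos hi, h2]
    · simp only [hB', if_neg hi]
      rw [h1 i j, h2, Finset.mul_sum, ← Finset.sum_sub_distrib]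
      exact Finset.sum_congr rfl fun t _ => by ring
  · let L : Matrix (Fin g) (Fin g) R := fun i j =>
      if j = k then A₁ i k else (1 : Matrix (Fin g) (Fin g) R) i j
    have hL : L * (show Matrix (Fin g) (Fin g) R from A') = S.1.submatrix s id := by
      ext i j
      rw [Matrix.mul_apply, Matrix.submatrix_apply]
      change _ = A₁ i j
      rw [← Finset.add_sum_erase _ _ (Finset.mem_univ k)]
      simp only [L, if_true, hA']
      by_cases hi : i = k
      · subst hi
        rw [Finset.sum_eq_zero, add_zero, ha]
        intro t ht
        rw [if_neg (Finset.ne_of_mem_erase ht),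
          Matrix.one_apply_ne (Finset.ne_of_mem_erase ht).symm, zero_mul]
      · rw [Finset.sum_eq_single i]
        · simp [hi]
        · intro t ht hti
          rw [if_neg (Finset.ne_of_mem_erase ht), Matrix.one_apply_ne hti.symm, zero_mul]
        · simp [hi]
    refine ⟨C.submatrix id s * L, ?_⟩
    rw [Matrix.mul_assoc]
    change C.submatrix id s * (L * (show Matrix (Fin g) (Fin g) R from A')) = 1
    rw [hL, Matrix.submatrix_mul_equiv, hC]
    rfl
  · intro j hj i
    change A' i j = _
    rw [hA']
    by_cases hjk : j = k
    · subst hjk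
      have h1 : a j = 1 := hpiv.mul_left_cancel (by rw [ha, mul_one])
      by_cases hi : i = j
      · rw [if_pos hi, h1, hi, Matrix.one_apply_eq]
      · simp [hi, h1]
    · have hjlt : j < k := hlt j (by simp [hjk, hj]) k List.mem_cons_self
      have h1 : ∀ i, A₁ i j = (1 : Matrix (Fin g) (Fin g) R) i j := fun i => by
        change S.1 (s i) j = _
        rw [hcl' j hjlt, Matrix.one_apply, Matrix.one_apply]
        congr 1
        rw [eq_iff_iff]
        conv_lhs => rw [← hsj j hjlt]
        exact s.apply_eq_iff_eq
      have h2 : a j = 0 := hpiv.mul_left_cancel (by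
        rw [ha, h1, Matrix.one_apply_ne hjlt.ne', mul_zero])
      by_cases hi : i = k
      · rw [if_pos hi, h2, hi, Matrix.one_apply_ne hjlt.ne']
      · rw [if_neg hi, h2, h1, mul_zero, sub_zero]

theorem isInversion_gaussJordan {R : Type u} [CommRing R] [IsLocalRing R] {g b : ℕ}
    (hb : 6 * g ^ 3 ≤ b) : IsInversion (gaussJordan (R := R) (g := g)) b := by
  intro A hA
  obtain ⟨C, hC⟩ := hA.exists_left_inv
  have h0 : GaussInv A (List.finRange g) (A, 1) :=
    ⟨List.pairwise_lt_finRange g, fun j hj => absurd (List.mem_finRange j) hj, (one_mul A).symm,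
      ⟨C, hC⟩, fun j hj => absurd (List.mem_finRange j) hj⟩
  refine (Comp.ensures_foldlM (b := 2 * g + 4 * g ^ 2) gaussStep (GaussInv A)
    (fun k l S hS => ensures_gaussStep hS) _ _ h0).bind fun S c hSc => Comp.ensures_pure ?_
  obtain ⟨hS, hc⟩ := hSc
  have h1 : S.2 * A = 1 := by
    rw [← hS.eq_mul]
    ext i j
    exact hS.cleared j (by simp) i
  refine ⟨mul_eq_one_comm.1 h1, h1, ?_⟩
  rw [List.length_finRange] at hc
  have : g * g ≤ g * g * g := by
    rcases Nat.eq_zero_or_pos g with rfl | hg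
    · simp
    · exact Nat.le_mul_of_pos_right _ hg
  simp only [add_zero]
  nlinarith

/-- Elements of norm 1 are units, and by the ultrametric inequality a and 1 - a cannot both have
norm less than 1. -/
theorem isLocalRing_ringOfInt (K : Type*) [NormedField K] [IsUltrametricDist K] :
    IsLocalRing (ringOfInt K) := by
  refine IsLocalRing.of_isUnit_or_isUnit_one_sub_self fun a => ?_
  have hunit : ∀ b : ringOfInt K, ‖(b : K)‖ = 1 → IsUnit b := fun b hb => by
    have hb0 : (b : K) ≠ 0 := norm_ne_zero_iff.1 (by simp [hb])
    refine IsUnit.of_mul_eq_one ⟨(b : K)⁻¹, ?_⟩ (Subtype.ext ?_)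
    · change ‖(b : K)⁻¹‖ ≤ 1
      simp [hb]
    · exact mul_inv_cancel₀ hb0
  by_cases ha : ‖(a : K)‖ = 1
  · exact Or.inl (hunit a ha)
  · refine Or.inr (hunit _ ?_)
    have hlt : ‖(a : K)‖ < 1 := lt_of_le_of_ne a.2 ha
    have h2 := (1 - a).2
    change ‖(1 : K) - a‖ ≤ 1 at h2
    have h1 := IsUltrametricDist.norm_add_le_max ((1 : K) - a) a
    rw [sub_add_cancel, norm_one, le_max_iff] at h1
    exact le_antisymm h2 (h1.resolve_right hlt.not_ge)

/-- A nonzero quotient of a local ring is local; the positivity of M keeps 1 out of the ideal. -/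
theorem isLocalRing_fixedPoint (p : ℕ) [Fact p.Prime] (K : Type*) [NormedField K]
    [IsUltrametricDist K] {M : ℝ} (hM : 0 < M) : IsLocalRing (FixedPoint p K M) := by
  have := isLocalRing_ringOfInt K
  have : Nontrivial (FixedPoint p K M) := by
    refine Ideal.Quotient.nontrivial_iff.2 fun h => ?_
    have h1 : (1 : ringOfInt K) ∈ precisionIdeal p K M := h ▸ Submodule.mem_top
    have h2 : ‖((1 : ringOfInt K) : K)‖ ≤ (p : ℝ) ^ (-M) := h1
    have h3 : (p : ℝ) ^ (-M) < 1 :=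
      Real.rpow_lt_one_of_one_lt_of_neg (mod_cast (Fact.out : p.Prime).one_lt) (neg_lt_zero.2 hM)
    simp only [OneMemClass.coe_one, norm_one] at h2
    linarith
  exact IsLocalRing.of_surjective' (reduceMod p K M) Ideal.Quotient.mk_surjective

/-! ### Congruence of power series up to a degree -/

/-- The coefficients of `a` and `b` agree up to degree `d`. -/
def CongrUpTo {R : Type*} [CommRing R] (d : ℕ) (a b : R⟦X⟧) : Prop :=
  ∀ k ≤ d, PowerSeries.coeff k a = PowerSeries.coeff k b

namespace CongrUpTo

variable {R : Type*} [CommRing R] {d e : ℕ} {a a' b b' c : R⟦X⟧}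

theorem refl (d : ℕ) (a : R⟦X⟧) : CongrUpTo d a a := fun _ _ => rfl

theorem symm (h : CongrUpTo d a b) : CongrUpTo d b a := fun k hk => (h k hk).symm

theorem trans (h : CongrUpTo d a b) (h' : CongrUpTo d b c) : CongrUpTo d a c :=
  fun k hk => (h k hk).trans (h' k hk)

theorem of_le (h : CongrUpTo e a b) (hde : d ≤ e) : CongrUpTo d a b :=
  fun k hk => h k (hk.trans hde)

theorem add (h : CongrUpTo d a a') (h' : CongrUpTo d b b') : CongrUpTo d (a + b) (a' + b') :=
  fun k hk => by rw [map_add, map_add, h k hk, h' k hk]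

theorem sub (h : CongrUpTo d a a') (h' : CongrUpTo d b b') : CongrUpTo d (a - b) (a' - b') :=
  fun k hk => by rw [map_sub, map_sub, h k hk, h' k hk]

theorem mul (h : CongrUpTo d a a') (h' : CongrUpTo d b b') : CongrUpTo d (a * b) (a' * b') :=
  fun k hk => by
    rw [PowerSeries.coeff_mul, PowerSeries.coeff_mul]
    refine Finset.sum_congr rfl fun ij hij => ?_
    have := Finset.HasAntidiagonal.mem_antidiagonal.1 hij
    rw [h _ (by omega), h' _ (by omega)]

theorem sum {ι : Type*} {s : Finset ι} {a b : ι → R⟦X⟧}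
    (h : ∀ i ∈ s, CongrUpTo d (a i) (b i)) : CongrUpTo d (∑ i ∈ s, a i) (∑ i ∈ s, b i) :=
  fun k hk => by
    rw [map_sum, map_sum]
    exact Finset.sum_congr rfl fun i hi => h i hi k hk

end CongrUpTo

theorem congrUpTo_matrix_mul {R : Type*} [CommRing R] {g d : ℕ}
    {A A' B B' : Matrix (Fin g) (Fin g) R⟦X⟧} (hA : ∀ i j, CongrUpTo d (A i j) (A' i j))
    (hB : ∀ i j, CongrUpTo d (B i j) (B' i j)) (i j : Fin g) :
    CongrUpTo d ((A * B) i j) ((A' * B') i j) := by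
  rw [Matrix.mul_apply, Matrix.mul_apply]
  exact CongrUpTo.sum fun l _ => (hA i l).mul (hB l j)

theorem congrUpTo_mulVec {R : Type*} [CommRing R] {g d : ℕ}
    {A A' : Matrix (Fin g) (Fin g) R⟦X⟧} {v v' : Fin g → R⟦X⟧}
    (hA : ∀ i j, CongrUpTo d (A i j) (A' i j)) (hv : ∀ j, CongrUpTo d (v j) (v' j))
    (i : Fin g) : CongrUpTo d (A.mulVec v i) (A'.mulVec v' i) := by
  simp only [Matrix.mulVec, dotProduct]
  exact CongrUpTo.sum fun l _ => (hA i l).mul (hv l)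

theorem coeff_toSeries {R : Type u} [CommRing R] {n : ℕ} (a : Fin n → R) (k : ℕ) :
    PowerSeries.coeff k (toSeries a) = coeffAt a k :=
  PowerSeries.coeff_mk _ _

theorem coeffAt_of_lt {R : Type u} [Zero R] {n k : ℕ} (a : Fin n → R) (h : k < n) :
    coeffAt a k = a ⟨k, h⟩ := dif_pos h

theorem coeffAt_of_le {R : Type u} [Zero R] {n k : ℕ} (a : Fin n → R) (h : n ≤ k) :
    coeffAt a k = 0 := dif_neg h.not_gt

theorem congrUpTo_toSeries_resize {R : Type u} [CommRing R] {n l d : ℕ} (a : Fin n → R)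
    (h : d < l ∨ n ≤ l) : CongrUpTo d (toSeries (resize l a)) (toSeries a) := fun k hk => by
  rw [coeff_toSeries, coeff_toSeries]
  by_cases hkl : k < l
  · rw [coeffAt_of_lt _ hkl, resize]
  · rw [coeffAt_of_le _ (not_lt.1 hkl), coeffAt_of_le a (by omega)]

/-- The vector of polynomials given by its coefficients. -/
def seriesVec {R : Type u} [CommRing R] {g n : ℕ} (x : TVec R g n) : Fin g → R⟦X⟧ :=
  fun i => toSeries (x i)

/-- The matrix of polynomials given by its coefficients. -/
def seriesMat {R : Type u} [CommRing R] {g n : ℕ} (h : TMat R g n) :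
    Matrix (Fin g) (Fin g) R⟦X⟧ :=
  Matrix.of fun i j => toSeries (h i j)

theorem coeff_seriesVec {R : Type u} [CommRing R] {g n : ℕ} (x : TVec R g n) (i : Fin g)
    {k : ℕ} (hk : k < n) : PowerSeries.coeff k (seriesVec x i) = x i ⟨k, hk⟩ := by
  rw [seriesVec, coeff_toSeries, coeffAt_of_lt _ hk]

theorem coeff_seriesMat {R : Type u} [CommRing R] {g n : ℕ} (h : TMat R g n) (i j : Fin g)
    {k : ℕ} (hk : k < n) : PowerSeries.coeff k (seriesMat h i j) = h i j ⟨k, hk⟩ := by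
  rw [seriesMat, Matrix.of_apply, coeff_toSeries, coeffAt_of_lt _ hk]

/-! ### One step of the algorithm as relations between power series -/

section Routines

variable {R : Type u} [CommRing R] {g : ℕ} {T : Routines R g}
  {f : Matrix (Fin g) (Fin g) R⟦X⟧} {MM C : ℕ → ℕ} {I : ℕ}

theorem Routines.Correct.ensures_mulMod (hT : T.Correct f MM C I) {a b : ℕ} (d : ℕ)
    (A : TMat R g a) (B : TMat R g b) :
    (T.matMul d (fun i j => resize (d + 1) (A i j)) fun i j => resize (d + 1) (B i j)).Ensures
      fun P c => (∀ i j, CongrUpTo d (toSeries (P i j)) ((seriesMat A * seriesMat B) i j)) ∧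
        c ≤ MM d := by
  refine (hT.matMul d _ _).mono fun P c ⟨hP, hc⟩ => ⟨fun i j => ?_, hc⟩
  rw [hP, Matrix.mul_apply]
  exact CongrUpTo.sum fun l _ => (congrUpTo_toSeries_resize _ (Or.inl d.lt_succ_self)).mul
    (congrUpTo_toSeries_resize _ (Or.inl d.lt_succ_self))

theorem Routines.Correct.ensures_mulVecMod (hT : T.Correct f MM C I) {a b : ℕ} {d n : ℕ}
    (A : TMat R g a) (v : TVec R g b) :
    (mulVecMod T d n A v).Ensures fun w c =>
      (∀ i k, k < n → k ≤ d → coeffAt (w i) k =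
        PowerSeries.coeff k ((seriesMat A).mulVec (seriesVec v) i)) ∧ c ≤ MM d := by
  refine (hT.ensures_mulMod d A fun i _ => v i).bind fun P c hPc => Comp.ensures_pure ?_
  refine ⟨fun i k hk hkd => ?_, hPc.2⟩
  rw [coeffAt_of_lt _ hk]
  change coeffAt (P i i) k = _
  rw [← coeff_toSeries, hPc.1 i i k hkd]
  rfl

/-- The relations between the values `x`, `h` at the half of `n` and the values `out` at `n`. -/
structure NewtonStep (f : Matrix (Fin g) (Fin g) R⟦X⟧) (G : Fin g → R⟦X⟧) (n : ℕ)
    (x : Fin g → R⟦X⟧) (h : Matrix (Fin g) (Fin g) R⟦X⟧) (x' : Fin g → R⟦X⟧)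
    (h' : Matrix (Fin g) (Fin g) R⟦X⟧) : Prop where
  inverse : ∀ i j, CongrUpTo (n / 2) (h' i j)
    ((2 * h - h * Hmap f x * h : Matrix (Fin g) (Fin g) R⟦X⟧) i j)
  solution : ∃ J : Fin g → R⟦X⟧, (∀ i, PowerSeries.constantCoeff (J i) = 0) ∧
    (∀ i, ∀ k < n, ((k : R) + 1) * PowerSeries.coeff (k + 1) (J i) = PowerSeries.coeff k
      (G i - (Hmap f x).mulVec (fun j => PowerSeries.derivative R (x j)) i)) ∧
    ∀ i, CongrUpTo n (x' i) (x i + h'.mulVec J i)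

/-- The divisions in the step from the half of `n` to `n` are possible. -/
def DivisionsDefined (f : Matrix (Fin g) (Fin g) R⟦X⟧) (G : Fin g → R⟦X⟧) (n : ℕ)
    (x : Fin g → R⟦X⟧) : Prop :=
  ∀ i, ∀ k < n, ((k : R) + 1) ∣ PowerSeries.coeff k
    (G i - (Hmap f x).mulVec (fun j => PowerSeries.derivative R (x j)) i)

/-- This separates program from mathematics: any property of the recursive output that makes the
divisions possible yields `NewtonStep`, where the arbitrary quotients appear as an existentially
quantified primitive. -/
theorem Routines.Correct.ensures_diffSolve (hT : T.Correct f MM C I) {G : Fin g → R⟦X⟧}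
    {n b : ℕ} (hn : n ≠ 0)
    {Q : TVec R g (n / 2 + 1) × TMat R g (n / 2 / 2 + 1) → Prop}
    (hQ : (diffSolve T f G (n / 2)).Ensures fun out c => Q out ∧ c ≤ b)
    (h0 : ∀ out, Q out → ∀ j, PowerSeries.constantCoeff (seriesVec out.1 j) = 0)
    (hdiv : ∀ out, Q out → DivisionsDefined f G n (seriesVec out.1)) :
    (diffSolve T f G n).Ensures fun out c =>
      (∃ prev, Q prev ∧ NewtonStep f G n (seriesVec prev.1) (seriesMat prev.2)
        (seriesVec out.1) (seriesMat out.2)) ∧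
      c ≤ b + (C n + 2 * MM (n / 2) + 2 * MM n + 2 * g ^ 2 * (n / 2 + 1) + 4 * g * (n + 1)) := by
  rw [diffSolve, dif_neg hn]
  refine hQ.bind fun prev c₀ ⟨hprev, hc₀⟩ => ?_
  obtain ⟨x, h⟩ := prev
  have hx0 := h0 _ hprev
  have hd := hdiv _ hprev
  dsimp only at hx0 hd ⊢
  -- As n ≥ 1, n / 2 + 1 ≤ n, so resizing only pads with zeros.
  have hxr : (fun j => toSeries (resize n (x j))) = seriesVec x :=
    funext fun j => PowerSeries.ext fun k =>
      congrUpTo_toSeries_resize (x j) (Or.inr (by omega)) k le_rfl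
  refine (hT.evalH n _ fun j => by rw [congrFun hxr j, hx0]).bind fun F c₁ ⟨hF, hc₁⟩ => ?_
  rw [hxr] at hF
  -- Degree n - 1 suffices: the residual is used modulo t ^ n, and the new inverse only up to degree
  -- n / 2 ≤ n - 1.
  have hF' : ∀ i j, CongrUpTo (n - 1) (seriesMat F i j) (Hmap f (seriesVec x) i j) :=
    fun i j k hk => by
      have hk' : k < n := by omega
      rw [coeff_seriesMat _ _ _ hk', hF]
  refine (hT.ensures_mulMod _ h F).bind fun P c₂ ⟨hP, hc₂⟩ => ?_
  refine (hT.ensures_mulMod _ P h).bind fun Q' c₃ ⟨hQ', hc₃⟩ => ?_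
  refine (Comp.ensures_tabulate (Q := fun i (v : Fin g → Fin (n / 2 + 1) → R) => ∀ j k,
    v j k = 2 * coeffAt (h i j) k - coeffAt (Q' i j) k) fun i =>
    Comp.ensures_tabulate (Q := fun j (v : Fin (n / 2 + 1) → R) => ∀ k,
      v k = 2 * coeffAt (h i j) k - coeffAt (Q' i j) k) fun j =>
    Comp.ensures_tabulate (b := 2) (Q := fun k z =>
      z = 2 * coeffAt (h i j) k - coeffAt (Q' i j) k) fun k =>
    (Comp.ensures_mul _ _).bind fun u c ⟨hu, hc⟩ => (Comp.ensures_sub _ _).mono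
      fun z c' ⟨hz, hc'⟩ => ⟨by rw [hz, hu], by omega⟩).bind fun h' c₄ ⟨hh', hc₄⟩ => ?_
  refine (Comp.ensures_tabulate (Q := fun i (v : Fin (n / 2) → R) => ∀ k : Fin (n / 2),
    v k = ((k : ℕ) + 1 : R) * coeffAt (x i) ((k : ℕ) + 1)) fun i =>
    Comp.ensures_tabulate fun k => Comp.ensures_mul _ _).bind fun dx c₅ ⟨hdx, hc₅⟩ => ?_
  have hdx' : ∀ j, seriesVec dx j = PowerSeries.derivative R (seriesVec x j) := fun j => by
    ext k
    rw [PowerSeries.coeff_derivative, seriesVec, seriesVec, coeff_toSeries, coeff_toSeries]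
    by_cases hk : k < n / 2
    · rw [coeffAt_of_lt _ hk, hdx, mul_comm]
    · rw [coeffAt_of_le _ (not_lt.1 hk), coeffAt_of_le _ (by omega), zero_mul]
  refine (hT.ensures_mulVecMod F dx).bind fun V c₆ ⟨hV, hc₆⟩ => ?_
  refine (Comp.ensures_tabulate (Q := fun i (v : Fin n → R) => ∀ k : Fin n,
    v k = PowerSeries.coeff (k : ℕ) (G i) - V i k) fun i =>
    Comp.ensures_tabulate fun k => Comp.ensures_sub _ _).bind fun E c₇ ⟨hE, hc₇⟩ => ?_
  have hE' : ∀ i (k : Fin n), E i k = PowerSeries.coeff (k : ℕ) (G i -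
      (Hmap f (seriesVec x)).mulVec (fun j => PowerSeries.derivative R (seriesVec x j)) i) :=
    fun i k => by
      rw [hE, ← coeffAt_of_lt (V i) k.2, hV i k k.2 k.2.le, map_sub,
        congrUpTo_mulVec hF' (fun j => CongrUpTo.refl _ _) i k (by omega), funext hdx']
  refine (Comp.ensures_tabulate (Q := fun i (v : Fin n → R) => ∀ k : Fin n,
    ((k : ℕ) + 1 : R) * v k = E i k) fun i =>
    Comp.ensures_tabulate fun k => Comp.ensures_div (by
      rw [hE']
      exact hd i k k.2)).bind fun J c₈ ⟨hJ, hc₈⟩ => ?_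
  set prim : TVec R g (n + 1) := fun i => Fin.cons (0 : R) (J i)
  have hprim0 : ∀ i, PowerSeries.constantCoeff (seriesVec prim i) = 0 := fun i => by
    rw [← PowerSeries.coeff_zero_eq_constantCoeff_apply, seriesVec, coeff_toSeries,
      coeffAt_of_lt _ n.succ_pos]
    rfl
  have hprimS : ∀ i (k : Fin n), PowerSeries.coeff ((k : ℕ) + 1) (seriesVec prim i) = J i k :=
    fun i k => by
      rw [seriesVec, coeff_toSeries, coeffAt_of_lt _ (Nat.succ_lt_succ k.2)]
      rfl
  refine (hT.ensures_mulVecMod h' prim).bind fun W c₉ ⟨hW, hc₉⟩ => ?_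
  refine (Comp.ensures_tabulate (Q := fun i (v : Fin (n + 1) → R) => ∀ k : Fin (n + 1),
    v k = coeffAt (x i) k + W i k) fun i =>
    Comp.ensures_tabulate fun k => Comp.ensures_add _ _).bind fun x' c₁₀ ⟨hx', hc₁₀⟩ => ?_
  refine Comp.ensures_pure ⟨⟨(x, h), hprev, ⟨fun i j k hk => ?_, seriesVec prim, hprim0,
    fun i k hk => ?_, fun i k hk => ?_⟩⟩, ?_⟩
  · have h1 := congrUpTo_matrix_mul (A := seriesMat P) (fun i j => (hP i j).trans
      (congrUpTo_matrix_mul (fun i j => CongrUpTo.refl _ _)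
        (fun i j => (hF' i j).of_le (by omega)) i j))
      (fun i j => CongrUpTo.refl _ (seriesMat h i j)) i j k hk
    rw [two_mul, Matrix.sub_apply, Matrix.add_apply, map_sub, map_add, ← h1, ← hQ' i j k hk,
      coeff_seriesMat _ _ _ (Nat.lt_succ_of_le hk)]
    refine (hh' i j _).trans ?_
    rw [seriesMat, Matrix.of_apply, coeff_toSeries, coeff_toSeries, two_mul]
  · have h1 := hJ i ⟨k, hk⟩
    rw [hE'] at h1
    rw [← h1, ← hprimS i ⟨k, hk⟩]
  · rw [map_add, coeff_seriesVec _ _ (Nat.lt_succ_of_le hk)]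
    refine (hx' i _).trans ?_
    rw [← hW i k (Nat.lt_succ_of_le hk) hk, coeffAt_of_lt (W i) (Nat.lt_succ_of_le hk),
      seriesVec, coeff_toSeries]
  · have h1 : n / 2 ≤ n := Nat.div_le_self _ _
    have h2 : g * (n / 2 * 1) ≤ g * n := by gcongr; omega
    nlinarith

end Routines

/-! ### The growth of denominators -/

section Denominators

variable (p : ℕ) [hp : Fact p.Prime] {K : Type u} [NormedField K]

theorem charZero_of_normedAlgebra (K : Type u) [NormedField K] [NormedAlgebra ℚ_[p] K] :
    CharZero K :=
  charZero_of_injective_algebraMap (algebraMap ℚ_[p] K).injective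

theorem exists_norm_natCast_mul_pow [NormedAlgebra ℚ_[p] K] {k : ℕ} (hk : k ≠ 0) :
    ∃ v : ℕ, p ^ v ≤ k ∧ ‖(k : K)‖ * (p : ℝ) ^ v = 1 := by
  refine ⟨padicValNat p k, Nat.le_of_dvd (Nat.pos_of_ne_zero hk) pow_padicValNat_dvd, ?_⟩
  have hp0 : (p : ℝ) ≠ 0 := mod_cast hp.out.ne_zero
  rw [← map_natCast (algebraMap ℚ_[p] K), norm_algebraMap', Padic.norm_eq_zpow_neg_valuation
    (mod_cast hk), Padic.valuation_natCast, ← zpow_natCast, ← zpow_add₀ hp0, neg_add_cancel,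
    zpow_zero]

theorem one_le_norm_natCast_mul_pow_log [NormedAlgebra ℚ_[p] K] {k : ℕ} (hk : k ≠ 0) :
    1 ≤ ‖(k : K)‖ * (p : ℝ) ^ Nat.log p k := by
  obtain ⟨v, hv, h⟩ := exists_norm_natCast_mul_pow (K := K) p hk
  rw [← h]
  gcongr
  · exact mod_cast hp.out.one_lt.le
  · exact Nat.le_log_of_pow_le hp.out.one_lt hv

/-- With v = v_p(k), p ^ v * p ^ ⌊log_p l⌋ ≤ k * l ≤ d. This inequality is what pays for dividing a
k-th power by k. -/
theorem pow_log_le_mul_pow_log [NormedAlgebra ℚ_[p] K] {k l d : ℕ} (hk : k ≠ 0) (hl : l ≠ 0)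
    (h : k * l ≤ d) : (p : ℝ) ^ Nat.log p l ≤ ‖(k : K)‖ * (p : ℝ) ^ Nat.log p d := by
  obtain ⟨v, hv, hk1⟩ := exists_norm_natCast_mul_pow (K := K) p hk
  have h1 : v + Nat.log p l ≤ Nat.log p d := by
    refine Nat.le_log_of_pow_le hp.out.one_lt ?_
    rw [pow_add]
    exact (Nat.mul_le_mul hv (Nat.pow_log_le_self p hl)).trans h
  calc (p : ℝ) ^ Nat.log p l = ‖(k : K)‖ * (p : ℝ) ^ (v + Nat.log p l) := by
        rw [pow_add, ← mul_assoc, hk1, one_mul]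
    _ ≤ _ := by
        gcongr
        exact mod_cast hp.out.one_lt.le

theorem pow_log_mono {d e : ℕ} (h : d ≤ e) : (p : ℝ) ^ Nat.log p d ≤ (p : ℝ) ^ Nat.log p e := by
  gcongr
  exact mod_cast hp.out.one_lt.le

end Denominators

/-! ### The error ideals and powers of an error -/

section ErrIdeal

variable (p : ℕ) [hp : Fact p.Prime] (K : Type u) [NormedField K] [IsUltrametricDist K] (M : ℝ)

/-- The power series whose coefficients of degree `d ≤ m` have valuation at least
`M - ⌊log_p d⌋`. -/
def errIdeal (m : ℕ) : Ideal (ringOfInt K)⟦X⟧ where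
  carrier := {a | ∀ d ≤ m,
    ‖((PowerSeries.coeff d a : ringOfInt K) : K)‖ ≤ (p : ℝ) ^ (-M) * p ^ Nat.log p d}
  zero_mem' := fun d _ => by
    simp only [map_zero, ZeroMemClass.coe_zero, norm_zero]
    positivity
  add_mem' := fun {a b} ha hb d hd => by
    rw [map_add]
    exact (IsUltrametricDist.norm_add_le_max _ _).trans (max_le (ha d hd) (hb d hd))
  smul_mem' := fun c a ha d hd => by
    rw [smul_eq_mul, PowerSeries.coeff_mul, AddSubmonoidClass.coe_finsetSum]
    refine IsUltrametricDist.norm_sum_le_of_forall_le_of_nonneg (by positivity) fun ij hij => ?_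
    have hij := Finset.HasAntidiagonal.mem_antidiagonal.1 hij
    rw [MulMemClass.coe_mul, norm_mul]
    calc _ ≤ 1 * ((p : ℝ) ^ (-M) * p ^ Nat.log p ij.2) := by
          gcongr
          · exact (PowerSeries.coeff ij.1 c).2
          · exact ha _ (by omega)
      _ ≤ _ := by
          rw [one_mul]
          exact mul_le_mul_of_nonneg_left (pow_log_mono p (by omega)) (by positivity)

variable {p K M}

theorem errIdeal_anti {m n : ℕ} (h : m ≤ n) : errIdeal p K M n ≤ errIdeal p K M m :=
  fun _ ha d hd => ha d (hd.trans h)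

/-- When i + j ≤ 2m + 1, one of i, j is at most m; that factor carries the bound and the other is
integral. -/
theorem mul_mem_errIdeal {m : ℕ} {a b : (ringOfInt K)⟦X⟧} (ha : a ∈ errIdeal p K M m)
    (hb : b ∈ errIdeal p K M m) : a * b ∈ errIdeal p K M (2 * m + 1) := fun d hd => by
  rw [PowerSeries.coeff_mul, AddSubmonoidClass.coe_finsetSum]
  refine IsUltrametricDist.norm_sum_le_of_forall_le_of_nonneg (by positivity) fun ij hij => ?_
  have hij := Finset.HasAntidiagonal.mem_antidiagonal.1 hij
  rw [MulMemClass.coe_mul, norm_mul]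
  rcases le_or_gt ij.1 m with h | h
  · refine (mul_le_of_le_one_right (norm_nonneg _) (PowerSeries.coeff ij.2 b).2).trans ?_
    exact (ha _ h).trans (mul_le_mul_of_nonneg_left (pow_log_mono p (by omega)) (by positivity))
  · refine (mul_le_of_le_one_left (norm_nonneg _) (PowerSeries.coeff ij.1 a).2).trans ?_
    exact (hb _ (by omega)).trans
      (mul_le_mul_of_nonneg_left (pow_log_mono p (by omega)) (by positivity))

theorem CongrUpTo.mem_errIdeal {m : ℕ} {a b : (ringOfInt K)⟦X⟧} (h : CongrUpTo m a b)
    (hb : b ∈ errIdeal p K M m) : a ∈ errIdeal p K M m := fun d hd => by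
  rw [h d hd]
  exact hb d hd

theorem sub_mem_errIdeal_of_congrUpTo {m : ℕ} {a b : (ringOfInt K)⟦X⟧}
    (h : CongrUpTo m (PowerSeries.map (reduceMod p K M) a)
      (PowerSeries.map (reduceMod p K M) b)) : a - b ∈ errIdeal p K M m := fun d hd => by
  have h1 := h d hd
  rw [PowerSeries.coeff_map, PowerSeries.coeff_map, Ideal.Quotient.mk_eq_mk_iff_sub_mem,
    ← map_sub] at h1
  have h2 : ‖((PowerSeries.coeff d (a - b) : ringOfInt K) : K)‖ ≤ (p : ℝ) ^ (-M) := h1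
  refine h2.trans (le_mul_of_one_le_right (by positivity) ?_)
  exact one_le_pow₀ (mod_cast hp.out.one_lt.le)

variable [NormedAlgebra ℚ_[p] K]

/-- Every term in the expansion of the coefficient contains a factor of index at most d / k; its
bound alone gives the claim, all other factors being integral. -/
theorem norm_coeff_pow_le {a : (ringOfInt K)⟦X⟧} (h0 : PowerSeries.constantCoeff a = 0)
    (ha : ∀ m, a ∈ errIdeal p K M m) {k : ℕ} (hk : k ≠ 0) (d : ℕ) :
    ‖((PowerSeries.coeff d (a ^ k) : ringOfInt K) : K)‖ ≤
      ‖(k : K)‖ * ((p : ℝ) ^ (-M) * p ^ Nat.log p d) := by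
  rw [PowerSeries.coeff_pow, AddSubmonoidClass.coe_finsetSum]
  refine IsUltrametricDist.norm_sum_le_of_forall_le_of_nonneg (by positivity) fun l hl => ?_
  obtain ⟨hsum, -⟩ := Finset.mem_finsuppAntidiag.1 hl
  -- Pigeonhole: the k indices l i have sum d.
  obtain ⟨i, hi, hik⟩ : ∃ i ∈ Finset.range k, k * l i ≤ d := by
    by_contra! h
    have h1 : ∑ i ∈ Finset.range k, d < ∑ i ∈ Finset.range k, k * l i :=
      Finset.sum_lt_sum_of_nonempty (by simpa using hk) h
    rw [← Finset.mul_sum, hsum] at h1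
    simp at h1
  rw [← Finset.mul_prod_erase _ _ hi, MulMemClass.coe_mul, norm_mul]
  refine (mul_le_of_le_one_right (norm_nonneg _) (Subtype.prop (_ : ringOfInt K))).trans ?_
  by_cases hli : l i = 0
  · rw [hli, PowerSeries.coeff_zero_eq_constantCoeff_apply, h0]
    simp only [ZeroMemClass.coe_zero, norm_zero]
    positivity
  · refine (ha (l i) _ le_rfl).trans ?_
    rw [mul_left_comm]
    exact mul_le_mul_of_nonneg_left (pow_log_le_mul_pow_log p hk hli hik) (by positivity)

/-- Split δ = δ₁ + δ₂ at degree m. Then δ^k = δ₁^k + k δ₁^(k-1) δ₂ + c δ₂², where the first term is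
divisible by k with control of the quotient, the second visibly so, and the third vanishes up to
degree 2m + 1. -/
theorem exists_congrUpTo_pow {m n k : ℕ} (hM : (p : ℝ) ^ (-M) * p ^ Nat.log p n ≤ 1)
    (hnm : n ≤ 2 * m + 1) {δ : (ringOfInt K)⟦X⟧} (h0 : PowerSeries.constantCoeff δ = 0)
    (hδ : δ ∈ errIdeal p K M m) (hk : 2 ≤ k) :
    ∃ e ∈ errIdeal p K M n, CongrUpTo n (δ ^ k) ((k : (ringOfInt K)⟦X⟧) * e) := by
  have := charZero_of_normedAlgebra p K
  have hk0 : (k : K) ≠ 0 := by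
    rw [Nat.cast_ne_zero]
    omega
  set δ₁ : (ringOfInt K)⟦X⟧ := PowerSeries.mk fun d =>
    if d ≤ m then PowerSeries.coeff d δ else 0 with hδ₁
  set δ₂ := δ - δ₁ with hδ₂
  have h1 : ∀ m', δ₁ ∈ errIdeal p K M m' := fun m' d _ => by
    rw [hδ₁, PowerSeries.coeff_mk]
    split_ifs with hd
    · exact hδ d hd
    · simp only [ZeroMemClass.coe_zero, norm_zero]
      positivity
  have h10 : PowerSeries.constantCoeff δ₁ = 0 := by
    rw [← PowerSeries.coeff_zero_eq_constantCoeff_apply, hδ₁, PowerSeries.coeff_mk,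
      if_pos (Nat.zero_le m), PowerSeries.coeff_zero_eq_constantCoeff_apply, h0]
  have h2 : PowerSeries.X ^ (m + 1) ∣ δ₂ := by
    rw [PowerSeries.X_pow_dvd_iff]
    intro d hd
    rw [hδ₂, map_sub, hδ₁, PowerSeries.coeff_mk, if_pos (Nat.le_of_lt_succ hd), sub_self]
  have hb : ∀ d ≤ n, ‖((PowerSeries.coeff d (δ₁ ^ k) : ringOfInt K) : K) / k‖ ≤
      (p : ℝ) ^ (-M) * p ^ Nat.log p d := fun d _ => by
    rw [norm_div, div_le_iff₀' (norm_pos_iff.2 hk0)]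
    exact norm_coeff_pow_le h10 h1 (by omega) d
  -- The quotient of δ₁ ^ k by k; `hM` makes its coefficients integral up to degree n.
  let e : (ringOfInt K)⟦X⟧ := PowerSeries.mk fun d =>
    if hd : d ≤ n then ⟨((PowerSeries.coeff d (δ₁ ^ k) : ringOfInt K) : K) / k, (hb d hd).trans
      ((mul_le_mul_of_nonneg_left (pow_log_mono p hd) (by positivity)).trans hM)⟩ else 0
  have he : ∀ d (hd : d ≤ n), ((PowerSeries.coeff d e : ringOfInt K) : K) =
      ((PowerSeries.coeff d (δ₁ ^ k) : ringOfInt K) : K) / k := fun d hd => by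
    rw [PowerSeries.coeff_mk, dif_pos hd]
  obtain ⟨c, hc⟩ := Polynomial.powAddExpansion δ₁ δ₂ k
  have hadd : δ₁ + δ₂ = δ := by rw [hδ₂]; ring
  refine ⟨e + δ₁ ^ (k - 1) * δ₂, Ideal.add_mem _ (fun d hd => ?_) ?_, fun d hd => ?_⟩
  · rw [he d hd]
    exact hb d hd
  -- Since k ≥ 2, a factor δ₁ is left, and the truncation δ₁ lies in the error ideals of all
  -- degrees.
  · obtain ⟨k, rfl⟩ := Nat.exists_eq_add_of_le' hk
    rw [show k + 2 - 1 = k + 1 from rfl, pow_succ, mul_right_comm]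
    exact Ideal.mul_mem_left _ _ (h1 n)
  · have h3 : PowerSeries.coeff d (c * δ₂ ^ 2) = 0 := by
      have h4 : PowerSeries.X ^ (n + 1) ∣ c * δ₂ ^ 2 := by
        refine Dvd.dvd.mul_left (Dvd.dvd.trans ?_ (pow_dvd_pow_of_dvd h2 2)) _
        rw [← pow_mul]
        exact pow_dvd_pow _ (by omega)
      exact PowerSeries.X_pow_dvd_iff.1 h4 d (Nat.lt_succ_of_le hd)
    have h5 : PowerSeries.coeff d (δ₁ ^ k) = PowerSeries.coeff d ((k : (ringOfInt K)⟦X⟧) * e) := by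
      apply Subtype.ext
      rw [← map_natCast (PowerSeries.C (R := ringOfInt K)), PowerSeries.coeff_C_mul,
        MulMemClass.coe_mul, he d hd]
      change _ = (k : K) * _
      field_simp
    rw [← hadd, hc, map_add, map_add, h3, h5, add_zero, ← map_add]
    rw [mul_add, mul_assoc]

/-- In the binomial expansion around x, each δ^(k+2) is k + 2 times an allowed error, and (k + 2) *
binom(r + 1, k + 2) = (r + 1) * binom(r, k + 1) lets r + 1 factor out. -/
theorem exists_congrUpTo_pow_succ_sub {m n : ℕ} (hM : (p : ℝ) ^ (-M) * p ^ Nat.log p n ≤ 1)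
    (hnm : n ≤ 2 * m + 1) {x y : (ringOfInt K)⟦X⟧} (hx : PowerSeries.constantCoeff x = 0)
    (hy : PowerSeries.constantCoeff y = 0) (hδ : y - x ∈ errIdeal p K M m) (r : ℕ) :
    ∃ q ∈ errIdeal p K M n,
      CongrUpTo n (y ^ (r + 1) - x ^ (r + 1))
        (((r + 1 : ℕ) : (ringOfInt K)⟦X⟧) * (x ^ r * (y - x) + q)) := by
  set δ := y - x with hδdef
  have hδ0 : PowerSeries.constantCoeff δ = 0 := by rw [hδdef, map_sub, hx, hy, sub_zero]
  have hex : ∀ k, ∃ e, e ∈ errIdeal p K M n ∧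
      CongrUpTo n (δ ^ (k + 2)) (((k + 2 : ℕ) : (ringOfInt K)⟦X⟧) * e) :=
    fun k => exists_congrUpTo_pow hM hnm hδ0 hδ (by omega)
  choose e he hpow using hex
  refine ⟨∑ k ∈ Finset.range r, (r.choose (k + 1) : (ringOfInt K)⟦X⟧) * x ^ (r - (k + 1)) * e k,
    Ideal.sum_mem _ fun k _ => Ideal.mul_mem_left _ _ (he k), ?_⟩
  have hyx : y = δ + x := by rw [hδdef]; ring
  have h1 : y ^ (r + 1) - x ^ (r + 1) = ((r + 1 : ℕ) : (ringOfInt K)⟦X⟧) * (x ^ r * δ) +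
      ∑ k ∈ Finset.range r, δ ^ (k + 2) *
        (x ^ (r - (k + 1)) * ((r + 1).choose (k + 2) : (ringOfInt K)⟦X⟧)) := by
    rw [hyx, add_pow, Finset.sum_range_succ', Finset.sum_range_succ']
    simp only [pow_zero, Nat.choose_zero_right, zero_add, Nat.choose_one_right, pow_one,
      Nat.sub_zero, Nat.add_sub_cancel, Nat.cast_one, one_mul, mul_one, add_assoc,
      Nat.reduceAdd]
    have : ∀ k, r + 1 - (k + 2) = r - (k + 1) := fun k => by omega
    simp only [this]
    push_cast
    ring_nf
  rw [h1, mul_add, Finset.mul_sum]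
  refine (CongrUpTo.refl _ _).add (CongrUpTo.sum fun k _ => ?_)
  refine ((hpow k).mul (CongrUpTo.refl _ _)).trans ?_
  have h2 : ((r + 1 : ℕ) : (ringOfInt K)⟦X⟧) * (r.choose (k + 1) : (ringOfInt K)⟦X⟧) =
      ((r + 1).choose (k + 2) : (ringOfInt K)⟦X⟧) * ((k + 2 : ℕ) : (ringOfInt K)⟦X⟧) := by
    rw [← Nat.cast_mul, ← Nat.cast_mul]
    exact congrArg _ (Nat.add_one_mul_choose_eq r (k + 1))
  have h3 := congrArg (· * (x ^ (r - (k + 1)) * e k)) h2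
  intro d _
  refine congrArg _ ?_
  linear_combination -h3

end ErrIdeal

/-! ### Substitution, derivatives and lifts of power series -/

section Substitution

variable {R : Type*} [CommRing R]

theorem congrUpTo_subst {x : R⟦X⟧} (hx : PowerSeries.constantCoeff x = 0) (f : R⟦X⟧) (n : ℕ) :
    CongrUpTo n (PowerSeries.subst x f)
      (∑ r ∈ Finset.range (n + 1), PowerSeries.coeff r f • x ^ r) := fun k hk => by
  rw [PowerSeries.coeff_subst' (PowerSeries.HasSubst.of_constantCoeff_zero' hx), map_sum]
  refine (finsum_eq_sum_of_support_subset _ fun r hr => ?_).trans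
    (Finset.sum_congr rfl fun r _ => (PowerSeries.coeff_smul _ _ _).symm)
  by_contra h
  have hkr : k < r := by
    simp only [Finset.coe_range, Set.mem_Iio] at h
    omega
  have h1 : PowerSeries.X ^ r ∣ x ^ r := pow_dvd_pow_of_dvd (PowerSeries.X_dvd_iff.2 hx) r
  exact hr (by
    dsimp only
    rw [PowerSeries.X_pow_dvd_iff.1 h1 k hkr, smul_zero])

theorem CongrUpTo.derivative {n : ℕ} {a b : R⟦X⟧} (h : CongrUpTo (n + 1) a b) :
    CongrUpTo n (PowerSeries.derivative R a) (PowerSeries.derivative R b) := fun k hk => by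
  rw [PowerSeries.coeff_derivative, PowerSeries.coeff_derivative, h _ (by omega)]

theorem CongrUpTo.smul {n : ℕ} {a b : R⟦X⟧} (c : R) (h : CongrUpTo n a b) :
    CongrUpTo n (c • a) (c • b) := fun k hk => by
  rw [PowerSeries.coeff_smul, PowerSeries.coeff_smul, h k hk]

theorem Hmap_map {R S : Type u} [CommRing R] [CommRing S] {g : ℕ} (φ : R →+* S)
    (f : Matrix (Fin g) (Fin g) R⟦X⟧) {x : Fin g → R⟦X⟧}
    (hx : ∀ j, PowerSeries.constantCoeff (x j) = 0) :
    Hmap (f.map (PowerSeries.map φ)) (fun j => PowerSeries.map φ (x j)) =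
      (Hmap f x).map (PowerSeries.map φ) := by
  ext1 i j
  exact (PowerSeries.map_subst (PowerSeries.HasSubst.of_constantCoeff_zero' (hx j)) _).symm

theorem map_derivative {S : Type*} [CommRing S] (φ : R →+* S) (a : R⟦X⟧) :
    PowerSeries.map φ (PowerSeries.derivative R a) =
      PowerSeries.derivative S (PowerSeries.map φ a) := by
  ext k
  simp [PowerSeries.coeff_derivative]

theorem map_mulVec {S : Type*} [CommRing S] {g : ℕ} (φ : R →+* S)
    (A : Matrix (Fin g) (Fin g) R) (v : Fin g → R) (i : Fin g) :
    φ (A.mulVec v i) = (A.map φ).mulVec (fun j => φ (v j)) i :=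
  RingHom.map_mulVec φ A v i

theorem exists_map_eq {S : Type*} [CommRing S] {φ : R →+* S} (hφ : Function.Surjective φ)
    (a : S⟦X⟧) : ∃ b, PowerSeries.map φ b = a := by
  choose s hs using hφ
  exact ⟨PowerSeries.mk fun k => s (PowerSeries.coeff k a), PowerSeries.ext fun k => by simp [hs]⟩

/-- Substituting a lift requires its constant term to vanish in O_K, not merely modulo p ^ M. -/
theorem exists_map_eq_of_constantCoeff {S : Type*} [CommRing S] {φ : R →+* S}
    (hφ : Function.Surjective φ) {a : S⟦X⟧} (ha : PowerSeries.constantCoeff a = 0) :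
    ∃ b, PowerSeries.map φ b = a ∧ PowerSeries.constantCoeff b = 0 := by
  obtain ⟨b, rfl⟩ := exists_map_eq hφ a
  refine ⟨b - PowerSeries.C (PowerSeries.constantCoeff b), ?_, by simp⟩
  rw [← PowerSeries.coeff_zero_eq_constantCoeff_apply, PowerSeries.coeff_map,
    PowerSeries.coeff_zero_eq_constantCoeff_apply] at ha
  rw [map_sub, PowerSeries.map_C, ha, map_zero, sub_zero]

end Substitution

/-! ### The residual of the differential equation is an exact derivative -/

section Residual

variable {p : ℕ} [hp : Fact p.Prime] {K : Type u} [NormedField K] [IsUltrametricDist K] {M : ℝ}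

theorem subst_sub_subst_mem_errIdeal {m : ℕ} {x y : (ringOfInt K)⟦X⟧}
    (hx : PowerSeries.constantCoeff x = 0) (hy : PowerSeries.constantCoeff y = 0)
    (h : y - x ∈ errIdeal p K M m) (f : (ringOfInt K)⟦X⟧) :
    PowerSeries.subst y f - PowerSeries.subst x f ∈ errIdeal p K M m := by
  refine ((congrUpTo_subst hy f m).sub (congrUpTo_subst hx f m)).mem_errIdeal ?_
  rw [← Finset.sum_sub_distrib]
  refine Ideal.sum_mem _ fun r _ => ?_
  rw [← smul_sub, PowerSeries.smul_eq_C_mul]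
  exact Ideal.mul_mem_left _ _ (Ideal.mem_of_dvd _ (sub_dvd_pow_sub_pow y x r) h)

variable [NormedAlgebra ℚ_[p] K]

theorem CongrUpTo.of_natCast_mul (p : ℕ) [Fact p.Prime] [NormedAlgebra ℚ_[p] K] {n k : ℕ}
    (hk : k ≠ 0) {a b : (ringOfInt K)⟦X⟧}
    (h : CongrUpTo n ((k : (ringOfInt K)⟦X⟧) * a) ((k : (ringOfInt K)⟦X⟧) * b)) :
    CongrUpTo n a b := fun d hd => by
  have := charZero_of_normedAlgebra p K
  have h1 := h d hd
  rw [← map_natCast (PowerSeries.C (R := ringOfInt K)), PowerSeries.coeff_C_mul,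
    PowerSeries.coeff_C_mul] at h1
  refine Subtype.ext (mul_left_cancel₀ (Nat.cast_ne_zero.2 hk : (k : K) ≠ 0) ?_)
  exact congrArg Subtype.val h1

/-- Both sides are linear in f, which reduces the claim to f = t^r. There it is the derivative of
the expansion of y^(r+1) - x^(r+1), with the factor r + 1 cancelled in characteristic zero.
Differentiation costs one degree, hence n + 1. -/
theorem exists_congrUpTo_subst_mul_derivative_sub {m n : ℕ}
    (hM : (p : ℝ) ^ (-M) * p ^ Nat.log p (n + 1) ≤ 1) (hnm : n + 1 ≤ 2 * m + 1)
    {x y : (ringOfInt K)⟦X⟧} (hx : PowerSeries.constantCoeff x = 0)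
    (hy : PowerSeries.constantCoeff y = 0) (hδ : y - x ∈ errIdeal p K M m)
    (f : (ringOfInt K)⟦X⟧) :
    ∃ q ∈ errIdeal p K M (n + 1), CongrUpTo n
      (PowerSeries.subst y f * PowerSeries.derivative _ y -
        PowerSeries.subst x f * PowerSeries.derivative _ x)
      (PowerSeries.derivative _ (PowerSeries.subst x f * (y - x) + q)) := by
  have hex : ∀ r : ℕ, ∃ q, q ∈ errIdeal p K M (n + 1) ∧ CongrUpTo n
      (y ^ r * PowerSeries.derivative _ y - x ^ r * PowerSeries.derivative _ x)
      (PowerSeries.derivative _ (x ^ r * (y - x) + q)) := fun r => by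
    obtain ⟨q, hq, hcongr⟩ := exists_congrUpTo_pow_succ_sub hM hnm hx hy hδ r
    refine ⟨q, hq, CongrUpTo.of_natCast_mul p r.succ_ne_zero ?_⟩
    have h1 := hcongr.derivative
    rw [map_sub, PowerSeries.derivative_pow, PowerSeries.derivative_pow, Nat.add_sub_cancel,
      Derivation.leibniz, Derivation.map_natCast, smul_zero, add_zero, smul_eq_mul] at h1
    convert h1 using 1
    ring
  choose q hq hcongr using hex
  refine ⟨∑ r ∈ Finset.range (n + 1 + 1), PowerSeries.coeff r f • q r,
    Ideal.sum_mem _ fun r _ => ?_, ?_⟩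
  · rw [PowerSeries.smul_eq_C_mul]
    exact Ideal.mul_mem_left _ _ (hq r)
  · have hsx := congrUpTo_subst hx f (n + 1)
    have hsy := congrUpTo_subst hy f (n + 1)
    refine (((hsy.of_le n.le_succ).mul (CongrUpTo.refl _ _)).sub
      ((hsx.of_le n.le_succ).mul (CongrUpTo.refl _ _))).trans (CongrUpTo.trans ?_
      ((hsx.mul (CongrUpTo.refl _ _)).add (CongrUpTo.refl _ _)).derivative.symm)
    rw [Finset.sum_mul, Finset.sum_mul, Finset.sum_mul, ← Finset.sum_sub_distrib,
      ← Finset.sum_add_distrib, map_sum]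
    refine CongrUpTo.sum fun r _ => ?_
    rw [smul_mul_assoc, smul_mul_assoc, smul_mul_assoc, ← smul_sub, ← smul_add, Derivation.map_smul]
    exact (hcongr r).smul _

variable {g : ℕ} {f : Matrix (Fin g) (Fin g) (ringOfInt K)⟦X⟧} {G X : Fin g → (ringOfInt K)⟦X⟧}

theorem IsSolution.exists_congrUpTo_residual (hX : IsSolution f G X) {m n : ℕ}
    (hM : (p : ℝ) ^ (-M) * p ^ Nat.log p (n + 1) ≤ 1) (hnm : n + 1 ≤ 2 * m + 1)
    {x : Fin g → (ringOfInt K)⟦X⟧} (hx : ∀ j, PowerSeries.constantCoeff (x j) = 0)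
    (hδ : ∀ j, x j - X j ∈ errIdeal p K M m) (i : Fin g) :
    ∃ q ∈ errIdeal p K M (n + 1), CongrUpTo n
      (G i - (Hmap f x).mulVec (fun j => PowerSeries.derivative _ (x j)) i)
      (PowerSeries.derivative _ (q - (Hmap f X).mulVec (fun j => x j - X j) i)) := by
  choose q hq hcongr using fun j =>
    exists_congrUpTo_subst_mul_derivative_sub hM hnm (hX.1 j) (hx j) (hδ j) (f i j)
  refine ⟨-∑ j, q j, neg_mem (Ideal.sum_mem _ fun j _ => hq j), ?_⟩
  have h1 := (CongrUpTo.refl n (0 : (ringOfInt K)⟦X⟧)).sub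
    (CongrUpTo.sum (s := Finset.univ) fun j _ => hcongr j)
  rw [← congrFun hX.2 i]
  convert h1 using 1
  · simp only [Matrix.mulVec, dotProduct, Finset.sum_sub_distrib, Hmap, Matrix.of_apply]
    ring
  · simp only [Matrix.mulVec, dotProduct, Finset.sum_add_distrib, Hmap, Matrix.of_apply, map_sum,
      map_add, map_sub, map_neg]
    ring

end Residual

/-! ### Newton iteration with errors -/

section Newton

variable {p : ℕ} [hp : Fact p.Prime] {K : Type u} [NormedField K] [IsUltrametricDist K] {M : ℝ}
  {g : ℕ}

theorem Matrix.mul_mem_of_left {A : Type*} [CommRing A] {I : Ideal A}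
    {P Q : Matrix (Fin g) (Fin g) A} (h : ∀ i j, P i j ∈ I) (i j : Fin g) :
    (P * Q) i j ∈ I := by
  rw [Matrix.mul_apply]
  exact Ideal.sum_mem _ fun l _ => Ideal.mul_mem_right _ _ (h i l)

theorem Matrix.mul_mem_of_right {A : Type*} [CommRing A] {I : Ideal A}
    {P Q : Matrix (Fin g) (Fin g) A} (h : ∀ i j, Q i j ∈ I) (i j : Fin g) :
    (P * Q) i j ∈ I := by
  rw [Matrix.mul_apply]
  exact Ideal.sum_mem _ fun l _ => Ideal.mul_mem_left _ _ (h l j)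

theorem Matrix.mulVec_mem_of_right {A : Type*} [CommRing A] {I : Ideal A}
    {P : Matrix (Fin g) (Fin g) A} {v : Fin g → A} (h : ∀ i, v i ∈ I) (i : Fin g) :
    P.mulVec v i ∈ I := by
  simp only [Matrix.mulVec, dotProduct]
  exact Ideal.sum_mem _ fun l _ => Ideal.mul_mem_left _ _ (h l)

/-- Reduction of the coefficients modulo `p ^ M`. -/
noncomputable abbrev reduceSeries (p : ℕ) [Fact p.Prime] (K : Type u) [NormedField K]
    [IsUltrametricDist K] (M : ℝ) : (ringOfInt K)⟦X⟧ →+* (FixedPoint p K M)⟦X⟧ :=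
  PowerSeries.map (reduceMod p K M)

/-- Every lift of `x` is `X` up to degree `n`, and every lift of `h` is a left inverse of `U` up to
degree `⌊n / 2⌋`, with the errors allowed by `errIdeal`. -/
structure ApproxSolution (M : ℝ) (X : Fin g → (ringOfInt K)⟦X⟧)
    (U : Matrix (Fin g) (Fin g) (ringOfInt K)⟦X⟧) (n : ℕ)
    (x : Fin g → (FixedPoint p K M)⟦X⟧) (h : Matrix (Fin g) (Fin g) (FixedPoint p K M)⟦X⟧) :
    Prop where
  solution : ∀ y : Fin g → (ringOfInt K)⟦X⟧,
    (∀ i, CongrUpTo n (reduceSeries p K M (y i)) (x i)) → ∀ i, y i - X i ∈ errIdeal p K M n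
  inverse : ∀ B : Matrix (Fin g) (Fin g) (ringOfInt K)⟦X⟧,
    (∀ i j, CongrUpTo (n / 2) (reduceSeries p K M (B i j)) (h i j)) →
    ∀ i j, (B * U - 1) i j ∈ errIdeal p K M (n / 2)

theorem reduceSeries_surjective : Function.Surjective (reduceSeries p K M) :=
  exists_map_eq Ideal.Quotient.mk_surjective

theorem exists_matrix_reduceSeries_eq (h : Matrix (Fin g) (Fin g) (FixedPoint p K M)⟦X⟧) :
    ∃ B : Matrix (Fin g) (Fin g) (ringOfInt K)⟦X⟧, B.map (reduceSeries p K M) = h := by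
  choose B hB using fun i j => reduceSeries_surjective (h i j)
  exact ⟨Matrix.of B, by ext1 i j; exact hB i j⟩

variable {f : Matrix (Fin g) (Fin g) (ringOfInt K)⟦X⟧} {G X : Fin g → (ringOfInt K)⟦X⟧} {n : ℕ}
  {x : Fin g → (FixedPoint p K M)⟦X⟧} {h : Matrix (Fin g) (Fin g) (FixedPoint p K M)⟦X⟧}

/-- As `Nat.log p 0 = 0`, no digits are lost in degree 0. -/
theorem ApproxSolution.constantCoeff_eq_zero {U : Matrix (Fin g) (Fin g) (ringOfInt K)⟦X⟧}
    (hxh : ApproxSolution M X U n x h) (hX : ∀ j, PowerSeries.constantCoeff (X j) = 0)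
    (j : Fin g) : PowerSeries.constantCoeff (x j) = 0 := by
  choose y hy using fun j => reduceSeries_surjective (x j)
  have h1 := hxh.solution y (fun i => hy i ▸ CongrUpTo.refl _ _) j 0 (Nat.zero_le n)
  rw [map_sub, PowerSeries.coeff_zero_eq_constantCoeff_apply,
    PowerSeries.coeff_zero_eq_constantCoeff_apply, hX, sub_zero, Nat.log_zero_right, pow_zero,
    mul_one] at h1
  rw [← hy, ← PowerSeries.coeff_zero_eq_constantCoeff_apply, PowerSeries.coeff_map,
    PowerSeries.coeff_zero_eq_constantCoeff_apply]
  exact Ideal.Quotient.eq_zero_iff_mem.2 h1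

/-- A lift without constant term of an approximate solution. -/
theorem ApproxSolution.exists_lift {U : Matrix (Fin g) (Fin g) (ringOfInt K)⟦X⟧}
    (hxh : ApproxSolution M X U n x h) (hX : ∀ j, PowerSeries.constantCoeff (X j) = 0) :
    ∃ y : Fin g → (ringOfInt K)⟦X⟧, (∀ j, PowerSeries.constantCoeff (y j) = 0) ∧
      (fun j => reduceSeries p K M (y j)) = x ∧ ∀ j, y j - X j ∈ errIdeal p K M n := by
  choose y hy hy0 using fun j => exists_map_eq_of_constantCoeff
    (φ := reduceMod p K M) Ideal.Quotient.mk_surjective (hxh.constantCoeff_eq_zero hX j)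
  exact ⟨y, hy0, funext hy, hxh.solution y fun i => hy i ▸ CongrUpTo.refl _ _⟩

theorem reduceSeries_residual {y : Fin g → (ringOfInt K)⟦X⟧}
    (hy : ∀ j, PowerSeries.constantCoeff (y j) = 0) (i : Fin g) :
    reduceSeries p K M (G i) - (Hmap (f.map (reduceSeries p K M))
        fun j => reduceSeries p K M (y j)).mulVec
        (fun j => PowerSeries.derivative _ (reduceSeries p K M (y j))) i =
      reduceSeries p K M
        (G i - (Hmap f y).mulVec (fun j => PowerSeries.derivative _ (y j)) i) := by
  rw [map_sub, map_mulVec, Hmap_map _ _ hy]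
  simp only [map_derivative]

theorem NewtonStep.inverse_mem (hX : IsSolution f G X) {y : Fin g → (ringOfInt K)⟦X⟧}
    (hy0 : ∀ j, PowerSeries.constantCoeff (y j) = 0)
    (hyX : ∀ j, y j - X j ∈ errIdeal p K M (n / 2))
    {B : Matrix (Fin g) (Fin g) (ringOfInt K)⟦X⟧}
    (hB : ∀ i j, (B * Hmap f X - 1) i j ∈ errIdeal p K M (n / 2 / 2))
    {x' : Fin g → (FixedPoint p K M)⟦X⟧} {h' : Matrix (Fin g) (Fin g) (FixedPoint p K M)⟦X⟧}
    (hstep : NewtonStep (f.map (reduceSeries p K M)) (fun i => reduceSeries p K M (G i)) n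
      (fun j => reduceSeries p K M (y j)) (B.map (reduceSeries p K M)) x' h')
    {B' : Matrix (Fin g) (Fin g) (ringOfInt K)⟦X⟧}
    (hB' : ∀ i j, CongrUpTo (n / 2) (reduceSeries p K M (B' i j)) (h' i j)) (i j : Fin g) :
    (B' * Hmap f X - 1) i j ∈ errIdeal p K M (n / 2) := by
  have h1 : ∀ i j, (B' - (B + B - B * Hmap f y * B) : Matrix (Fin g) (Fin g) _) i j ∈
      errIdeal p K M (n / 2) := fun i j => by
    refine sub_mem_errIdeal_of_congrUpTo ((hB' i j).trans ((hstep.inverse i j).trans ?_))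
    rw [Hmap_map _ _ hy0, two_mul, ← Matrix.map_mul, ← Matrix.map_mul, Matrix.sub_apply,
      Matrix.sub_apply, Matrix.add_apply, Matrix.add_apply, map_sub, map_add]
    exact CongrUpTo.refl _ _
  have h2 : ∀ i j, (Hmap f y - Hmap f X) i j ∈ errIdeal p K M (n / 2) := fun i j =>
    subst_sub_subst_mem_errIdeal (hX.1 j) (hy0 j) (hyX j) (f i j)
  have h3 : ∀ i j, ((B * Hmap f X - 1) * (B * Hmap f X - 1)) i j ∈ errIdeal p K M (n / 2) :=
    fun i j => by
      rw [Matrix.mul_apply]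
      exact Ideal.sum_mem _ fun l _ =>
        errIdeal_anti (by omega) (mul_mem_errIdeal (hB i l) (hB l j))
  -- With U = H_f(X): a rounding error, the Newton square of B U - 1, and the effect of evaluating
  -- H_f at y instead of X.
  have h4 : B' * Hmap f X - 1 = (B' - (B + B - B * Hmap f y * B)) * Hmap f X
      - (B * Hmap f X - 1) * (B * Hmap f X - 1)
      - B * (Hmap f y - Hmap f X) * (B * Hmap f X) := by
    noncomm_ring
  rw [h4]
  exact sub_mem (sub_mem (Matrix.mul_mem_of_left h1 i j) (h3 i j))
    (Matrix.mul_mem_of_left (Matrix.mul_mem_of_right h2) i j)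

variable [NormedAlgebra ℚ_[p] K]

theorem ApproxSolution.divisionsDefined (hX : IsSolution f G X)
    (hM : (p : ℝ) ^ (-M) * p ^ Nat.log p n ≤ 1)
    (hxh : ApproxSolution M X (Hmap f X) (n / 2) x h) :
    DivisionsDefined (f.map (reduceSeries p K M)) (fun i => reduceSeries p K M (G i)) n x := by
  intro i k hk
  obtain ⟨y, hy0, rfl, hyX⟩ := hxh.exists_lift hX.1
  obtain ⟨n, rfl⟩ := Nat.exists_eq_succ_of_ne_zero (Nat.ne_zero_of_lt hk)
  obtain ⟨q, -, hq⟩ := hX.exists_congrUpTo_residual hM (by omega) hy0 hyX i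
  rw [reduceSeries_residual hy0, PowerSeries.coeff_map, hq k (by omega),
    PowerSeries.coeff_derivative, map_mul, map_add, map_one, map_natCast]
  exact dvd_mul_left _ _

/-- The exact primitive is q - u with u = U (y - X). After multiplication by k + 1, J agrees with it
modulo p ^ M, so at most v_p(k + 1) digits are lost. -/
theorem IsSolution.primitive_add_mem (hX : IsSolution f G X)
    (hM : (p : ℝ) ^ (-M) * p ^ Nat.log p n ≤ 1) (hn : n ≠ 0)
    {y : Fin g → (ringOfInt K)⟦X⟧} (hy0 : ∀ j, PowerSeries.constantCoeff (y j) = 0)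
    (hyX : ∀ j, y j - X j ∈ errIdeal p K M (n / 2)) {J : (ringOfInt K)⟦X⟧}
    (hJ0 : PowerSeries.constantCoeff J = 0) {i : Fin g}
    (hJ : ∀ k < n, reduceMod p K M (((k + 1 : ℕ) : ringOfInt K) * PowerSeries.coeff (k + 1) J) =
      reduceMod p K M (PowerSeries.coeff k
        (G i - (Hmap f y).mulVec (fun j => PowerSeries.derivative _ (y j)) i))) :
    J + (Hmap f X).mulVec (fun j => y j - X j) i ∈ errIdeal p K M n := by
  obtain ⟨n, rfl⟩ := Nat.exists_eq_succ_of_ne_zero hn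
  obtain ⟨q, hqmem, hq⟩ := hX.exists_congrUpTo_residual hM (by omega) hy0 hyX i
  have hu : PowerSeries.constantCoeff ((Hmap f X).mulVec (fun j => y j - X j) i) = 0 := by
    simp [Matrix.mulVec, dotProduct, hy0, hX.1]
  generalize (Hmap f X).mulVec (fun j => y j - X j) i = u at hq hu ⊢
  have h1 : J - (q - u) ∈ errIdeal p K M (n + 1) := fun d hd => by
    rcases d with _ | k
    · have h3 : PowerSeries.coeff 0 (J - (q - u)) = PowerSeries.coeff 0 (-q) := by
        simp [hu, hJ0]
      rw [h3]
      exact neg_mem hqmem 0 (Nat.zero_le _)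
    · have h2 := hJ k (by omega)
      rw [hq k (by omega), PowerSeries.coeff_derivative, Ideal.Quotient.mk_eq_mk_iff_sub_mem] at h2
      have h3 : ((k + 1 : ℕ) : ringOfInt K) * PowerSeries.coeff (k + 1) (J - (q - u)) ∈
          precisionIdeal p K M := by
        convert h2 using 1
        rw [map_sub]
        push_cast
        ring
      have h4 : ‖((k + 1 : ℕ) : K) *
          ((PowerSeries.coeff (k + 1) (J - (q - u)) : ringOfInt K) : K)‖ ≤ (p : ℝ) ^ (-M) := h3
      rw [norm_mul] at h4
      have h5 := one_le_norm_natCast_mul_pow_log (K := K) p k.succ_ne_zero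
      generalize ((PowerSeries.coeff (k + 1) (J - (q - u)) : ringOfInt K) : K) = c at h4 ⊢
      calc ‖c‖ ≤ ‖c‖ * (‖((k + 1 : ℕ) : K)‖ * (p : ℝ) ^ Nat.log p (k + 1)) :=
            le_mul_of_one_le_right (norm_nonneg _) h5
        _ = ‖((k + 1 : ℕ) : K)‖ * ‖c‖ * (p : ℝ) ^ Nat.log p (k + 1) := by ring
        _ ≤ _ := by gcongr
  have h2 := add_mem h1 hqmem
  rwa [show J - (q - u) + q = J + u by ring] at h2

theorem NewtonStep.approxSolution (hX : IsSolution f G X)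
    (hM : (p : ℝ) ^ (-M) * p ^ Nat.log p n ≤ 1) (hn : n ≠ 0)
    (hxh : ApproxSolution M X (Hmap f X) (n / 2) x h)
    {x' : Fin g → (FixedPoint p K M)⟦X⟧} {h' : Matrix (Fin g) (Fin g) (FixedPoint p K M)⟦X⟧}
    (hstep : NewtonStep (f.map (reduceSeries p K M)) (fun i => reduceSeries p K M (G i)) n
      x h x' h') : ApproxSolution M X (Hmap f X) n x' h' := by
  obtain ⟨y, hy0, rfl, hyX⟩ := hxh.exists_lift hX.1
  obtain ⟨B, rfl⟩ := exists_matrix_reduceSeries_eq h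
  have hB := hxh.inverse B fun i j => CongrUpTo.refl _ _
  have hinv := fun B' => hstep.inverse_mem hX hy0 hyX hB (B' := B')
  refine ⟨fun z hz i => ?_, hinv⟩
  obtain ⟨B', rfl⟩ := exists_matrix_reduceSeries_eq h'
  have hB' := hinv B' fun i j => CongrUpTo.refl _ _
  obtain ⟨J, hJ0, hJ, hx'⟩ := hstep.solution
  choose J' hJ' hJ'0 using fun j => exists_map_eq_of_constantCoeff
    (φ := reduceMod p K M) Ideal.Quotient.mk_surjective (hJ0 j)
  have hJ'mem : ∀ i, J' i + (Hmap f X).mulVec (fun j => y j - X j) i ∈ errIdeal p K M n :=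
    fun i => hX.primitive_add_mem hM hn hy0 hyX (hJ'0 i) fun k hk => by
      have h2 := hJ i k hk
      rw [reduceSeries_residual hy0, PowerSeries.coeff_map, ← hJ' i, PowerSeries.coeff_map] at h2
      rw [← h2, map_mul, map_natCast, Nat.cast_succ]
  have h1 : z i - (y i + B'.mulVec J' i) ∈ errIdeal p K M n := by
    refine sub_mem_errIdeal_of_congrUpTo ((hz i).trans ((hx' i).trans ?_))
    rw [map_add, map_mulVec, ← funext hJ']
    exact CongrUpTo.refl _ _
  have h2 : (B' * Hmap f X - 1).mulVec (fun j => y j - X j) i ∈ errIdeal p K M n := by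
    simp only [Matrix.mulVec, dotProduct]
    exact Ideal.sum_mem _ fun l _ =>
      errIdeal_anti (by omega) (mul_mem_errIdeal (hB' i l) (hyX l))
  have h3 := Matrix.mulVec_mem_of_right (P := B') hJ'mem i
  -- The rounding error, the product of two errors known up to degree n / 2, and the error of the
  -- primitive multiplied by an integral matrix.
  have h4 : z i - X i = z i - (y i + B'.mulVec J' i) -
      (B' * Hmap f X - 1).mulVec (fun j => y j - X j) i +
      B'.mulVec (fun j => J' j + (Hmap f X).mulVec (fun j => y j - X j) j) i := by
    change _ = _ - _ - _ + B'.mulVec (J' + (Hmap f X).mulVec (fun j => y j - X j)) i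
    rw [Matrix.mulVec_add, Matrix.sub_mulVec, Matrix.one_mulVec, Matrix.mulVec_mulVec]
    simp only [Pi.add_apply, Pi.sub_apply]
    ring
  rw [h4]
  exact add_mem (sub_mem h1 h2) h3

end Newton

/-! ### The cost recursion -/

/-- The number of operations of `diffSolve`, in terms of the costs of the routines. -/
def diffSolveCost (g : ℕ) (MM C : ℕ → ℕ) (I n : ℕ) : ℕ :=
  if _hn : n = 0 then I else diffSolveCost g MM C I (n / 2) +
    (C n + 2 * MM (n / 2) + 2 * MM n + 2 * g ^ 2 * (n / 2 + 1) + 4 * g * (n + 1))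
termination_by n
decreasing_by omega

theorem two_mul_le_of_superadditive {F : ℕ → ℕ}
    (hF : ∀ a b, 1 ≤ a → 1 ≤ b → F a + F b ≤ F (a + b)) {n : ℕ} (hn : 2 ≤ n) :
    2 * F (n / 2) ≤ F n := by
  rcases Nat.even_or_odd' n with ⟨m, rfl | rfl⟩
  · have h1 := hF m m (by omega) (by omega)
    rw [Nat.mul_div_cancel_left m two_pos]
    rw [← two_mul m] at h1
    omega
  · have h1 := hF m m (by omega) (by omega)
    have h2 := hF (m + m) 1 (by omega) le_rfl
    rw [show (2 * m + 1) / 2 = m by omega]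
    rw [← two_mul m] at h1 h2
    omega

/-- The scalar operations are absorbed into `MM`, so one step costs at most 10 * MM n + C n; halving
n at least halves both terms, and the sum at most doubles. -/
theorem CostAssumptions.diffSolveCost_le {g : ℕ} {MM C : ℕ → ℕ} (h : CostAssumptions g MM C)
    (I : ℕ) {n : ℕ} (hn : 1 ≤ n) : diffSolveCost g MM C I n ≤ 20 * MM n + 2 * C n + I := by
  induction n using Nat.strong_induction_on with
  | _ n ih =>
    have h1 : MM (n / 2) ≤ MM n := h.monotone_MM (Nat.div_le_self n 2)
    have h2 : 2 * g ^ 2 * (n / 2 + 1) ≤ 2 * MM (n / 2) := by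
      rw [mul_assoc]
      exact Nat.mul_le_mul_left 2 (h.size_le_MM _)
    have h3 : 4 * g * (n + 1) ≤ 4 * MM n := by
      rw [mul_assoc]
      refine Nat.mul_le_mul_left 4 (le_trans ?_ (h.size_le_MM n))
      exact Nat.mul_le_mul_right _ (Nat.le_self_pow two_ne_zero g)
    rw [diffSolveCost, dif_neg (by omega)]
    -- For n = 1 the half is 0, where superadditivity says nothing; monotonicity bounds MM 0.
    rcases Nat.lt_or_ge n 2 with hn2 | hn2
    · rw [show n / 2 = 0 by omega] at h1 h2 ⊢
      rw [diffSolveCost, dif_pos rfl]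
      omega
    · have h4 := ih (n / 2) (by omega) (by omega)
      have h5 := two_mul_le_of_superadditive h.superadd_MM hn2
      have h6 := two_mul_le_of_superadditive h.superadd_C hn2
      omega

/-- `MM` contributes a factor A ^ 2, `C` and `I` a factor A, and 21 (A² + A) + A ≤ 21 (1 + A)². -/
theorem cost_le_of_exponent {g n MM₁ MM C I cost : ℕ} (hg : 1 ≤ g) (hn : 1 ≤ n)
    (hcost : cost ≤ 21 * (MM + C) + I) {ω A : ℝ} {k : ℕ} (hA : 0 ≤ A)
    (hMM : (MM : ℝ) ≤ A * (g : ℝ) ^ ω * MM₁)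
    (hMM₁ : (MM₁ : ℝ) ≤ A * n * (1 + Real.log n) ^ k)
    (hC : (C : ℝ) ≤ A * (g : ℝ) ^ ω * n * (1 + Real.log (g * n)) ^ k)
    (hI : (I : ℝ) ≤ A * (g : ℝ) ^ ω * (1 + Real.log g) ^ k) :
    (cost : ℝ) ≤ (21 : ℕ) * (1 + A) ^ 2 * (g : ℝ) ^ ω * n * (1 + Real.log (g * n)) ^ k := by
  have hg' : (1 : ℝ) ≤ g := mod_cast hg
  have hn' : (1 : ℝ) ≤ n := mod_cast hn
  have hlg := Real.log_nonneg hg'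
  have hln := Real.log_nonneg hn'
  have hlog : Real.log (g * n) = Real.log g + Real.log n :=
    Real.log_mul (by positivity) (by positivity)
  have hW : 0 < (g : ℝ) ^ ω := by positivity
  have h1 : (1 + Real.log n) ^ k ≤ (1 + Real.log (g * n)) ^ k := by
    rw [hlog]
    gcongr
    linarith
  have h2 : (1 + Real.log g) ^ k ≤ (1 + Real.log (g * n)) ^ k := by
    rw [hlog]
    gcongr
    linarith
  have hΛ : 0 ≤ (1 + Real.log (g * n)) ^ k := (pow_nonneg (by linarith) k).trans h2
  generalize (1 + Real.log (g * n)) ^ k = Λ at *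
  generalize (g : ℝ) ^ ω = W at *
  have hB : 0 ≤ W * n * Λ := by positivity
  have h3 : (MM : ℝ) ≤ A ^ 2 * (W * n * Λ) := by
    calc (MM : ℝ) ≤ A * W * MM₁ := hMM
      _ ≤ A * W * (A * n * Λ) := by
        gcongr
        exact hMM₁.trans (by gcongr)
      _ = _ := by ring
  have h4 : (C : ℝ) ≤ A * (W * n * Λ) := hC.trans_eq (by ring)
  have h5 : (I : ℝ) ≤ A * (W * n * Λ) := by
    calc (I : ℝ) ≤ A * W * Λ := hI.trans (by gcongr)
      _ ≤ A * W * Λ * n := le_mul_of_one_le_right (by positivity) hn'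
      _ = _ := by ring
  have h6 : (cost : ℝ) ≤ 21 * (MM + C) + I := mod_cast hcost
  push_cast
  nlinarith [mul_nonneg hA hB]

/-! ### Assembling the theorem -/

section Main

variable {p : ℕ} [hp : Fact p.Prime] {K : Type u} [NormedField K] [IsUltrametricDist K] {M : ℝ}
  {g : ℕ} {f : Matrix (Fin g) (Fin g) (ringOfInt K)⟦X⟧} {G X : Fin g → (ringOfInt K)⟦X⟧}

theorem approxSolution_zero (hX : ∀ j, PowerSeries.constantCoeff (X j) = 0)
    {B : Matrix (Fin g) (Fin g) (FixedPoint p K M)}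
    (hB : B * Hzero (f.map (reduceSeries p K M)) = 1)
    {x : Fin g → (FixedPoint p K M)⟦X⟧} {h : Matrix (Fin g) (Fin g) (FixedPoint p K M)⟦X⟧}
    (hx : ∀ i, PowerSeries.coeff 0 (x i) = 0) (hh : ∀ i j, PowerSeries.coeff 0 (h i j) = B i j) :
    ApproxSolution M X (Hmap f X) 0 x h := by
  refine ⟨fun y hy i => sub_mem_errIdeal_of_congrUpTo ((hy i).trans fun k hk => ?_),
    fun B' hB' i j => sub_mem_errIdeal_of_congrUpTo fun k hk => ?_⟩
  · obtain rfl := Nat.le_zero.1 hk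
    rw [hx, PowerSeries.coeff_map, PowerSeries.coeff_zero_eq_constantCoeff_apply, hX, map_zero]
  · obtain rfl := Nat.le_zero.1 hk
    have hU : ∀ l, PowerSeries.coeff 0 (Hmap f X l j) = Hzero f l j := fun l => by
      rw [Hmap, Matrix.of_apply, congrUpTo_subst (hX j) (f l j) 0 0 le_rfl]
      simp [Hzero]
    have h1 : ∀ l, reduceMod p K M (PowerSeries.coeff 0 (B' i l)) = B i l := fun l => by
      rw [← PowerSeries.coeff_map, hB' i l 0 (Nat.zero_le _), hh]
    have h2 : ∀ l, reduceMod p K M (Hzero f l j) = Hzero (f.map (reduceSeries p K M)) l j :=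
      fun l => by
        simp only [Hzero, Matrix.map_apply, ← PowerSeries.coeff_zero_eq_constantCoeff_apply,
          PowerSeries.coeff_map]
    have h3 : reduceMod p K M (PowerSeries.coeff 0 ((B' * Hmap f X) i j)) =
        (1 : Matrix (Fin g) (Fin g) (FixedPoint p K M)) i j := by
      rw [← hB, Matrix.mul_apply, Matrix.mul_apply, map_sum, map_sum]
      refine Finset.sum_congr rfl fun l _ => ?_
      rw [PowerSeries.coeff_mul, Finset.HasAntidiagonal.antidiagonal_zero, Finset.sum_singleton,
        map_mul, h1, hU, h2]
    rw [PowerSeries.coeff_map, PowerSeries.coeff_map, h3, Matrix.one_apply, Matrix.one_apply]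
    split_ifs <;> simp

/-- The allowed loss is largest in degree n, and there `hMN` still leaves N digits. -/
theorem ApproxSolution.correctOutput {n : ℕ} {N : ℝ}
    (hMN : (p : ℝ) ^ (-M) * p ^ Nat.log p n ≤ (p : ℝ) ^ (-N))
    {U : Matrix (Fin g) (Fin g) (ringOfInt K)⟦X⟧}
    {out : TVec (FixedPoint p K M) g (n + 1) × TMat (FixedPoint p K M) g (n / 2 + 1)}
    (h : ApproxSolution M X U n (seriesVec out.1) (seriesMat out.2)) :
    CorrectOutput p M N (fun i => PowerSeries.map (ringOfInt K).subtype (X i))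
      (U.map (PowerSeries.map (ringOfInt K).subtype)) out := by
  have hmono : ∀ d ≤ n, (p : ℝ) ^ (-M) * p ^ Nat.log p d ≤ (p : ℝ) ^ (-N) := fun d hd =>
    (mul_le_mul_of_nonneg_left (pow_log_mono p hd) (by positivity)).trans hMN
  refine ⟨fun i k a ha => ?_, fun B hB i j k => ?_⟩
  · choose y hy using fun j => reduceSeries_surjective (seriesVec out.1 j)
    have h1 := h.solution y (fun j => hy j ▸ CongrUpTo.refl _ _) i k (Nat.le_of_lt_succ k.2)
    have h2 : reduceMod p K M a = reduceMod p K M (PowerSeries.coeff (k : ℕ) (y i)) := by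
      rw [← PowerSeries.coeff_map, hy, coeff_seriesVec _ _ k.2, ha]
    have h3 : ‖(a : K) - (PowerSeries.coeff (k : ℕ) (y i) : ringOfInt K)‖ ≤ (p : ℝ) ^ (-M) :=
      (Ideal.Quotient.mk_eq_mk_iff_sub_mem _ _).1 h2
    have h4 := IsUltrametricDist.norm_add_le_max
      ((a : K) - (PowerSeries.coeff (k : ℕ) (y i) : ringOfInt K))
      ((PowerSeries.coeff (k : ℕ) (y i - X i) : ringOfInt K) : K)
    rw [map_sub, AddSubgroupClass.coe_sub, sub_add_sub_cancel] at h4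
    rw [PowerSeries.coeff_map]
    refine h4.trans (max_le ?_ ?_)
    · have := hmono 0 (Nat.zero_le _)
      rw [Nat.log_zero_right, pow_zero, mul_one] at this
      exact h3.trans this
    · rw [map_sub] at h1
      exact h1.trans (hmono _ (Nat.le_of_lt_succ k.2))
  · have h1 := h.inverse B (fun i j d hd => by
      rw [PowerSeries.coeff_map, coeff_seriesMat _ _ _ (Nat.lt_succ_of_le hd)]
      exact hB i j ⟨d, Nat.lt_succ_of_le hd⟩) i j k (Nat.le_of_lt_succ k.2)
    have h2 : B.map (PowerSeries.map (ringOfInt K).subtype) *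
        U.map (PowerSeries.map (ringOfInt K).subtype) - 1 =
        (B * U - 1).map (PowerSeries.map (ringOfInt K).subtype) := by
      rw [← Matrix.map_mul, Matrix.map_sub _ (map_sub _), Matrix.map_one _ (map_zero _) (map_one _)]
    rw [h2, Matrix.map_apply, PowerSeries.coeff_map]
    exact h1.trans (hmono _ ((Nat.le_of_lt_succ k.2).trans (Nat.div_le_self _ _)))

theorem map_subtype_injective :
    Function.Injective (PowerSeries.map (ringOfInt K).subtype) := fun a b hab => by
  ext k
  have := congrArg (PowerSeries.coeff k) hab
  rwa [PowerSeries.coeff_map, PowerSeries.coeff_map] at this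

theorem IsSolution.of_map (hX : IsSolution (f.map (PowerSeries.map (ringOfInt K).subtype))
    (fun i => PowerSeries.map (ringOfInt K).subtype (G i))
    fun i => PowerSeries.map (ringOfInt K).subtype (X i)) : IsSolution f G X := by
  have h0 : ∀ j, PowerSeries.constantCoeff (X j) = 0 := fun j => by
    have := hX.1 j
    rw [← PowerSeries.coeff_zero_eq_constantCoeff_apply, PowerSeries.coeff_map,
      PowerSeries.coeff_zero_eq_constantCoeff_apply] at this
    exact Subtype.ext this
  refine ⟨h0, funext fun i => map_subtype_injective ?_⟩
  rw [← congrFun hX.2 i, map_mulVec, Hmap_map _ _ h0]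
  simp only [map_derivative]

theorem rpow_neg_workingPrecision_mul_le (p n : ℕ) [hp : Fact p.Prime] (N : ℝ) :
    (p : ℝ) ^ (-workingPrecision p n N) * p ^ Nat.log p n ≤ (p : ℝ) ^ (-N) := by
  have hp1 : (1 : ℝ) < p := mod_cast hp.out.one_lt
  rw [← Real.rpow_natCast, ← Real.rpow_add (by positivity)]
  refine Real.rpow_le_rpow_of_exponent_le hp1.le ?_
  unfold workingPrecision
  have : N ≤ if p = 2 then max N 3 else if p = 3 then max N 2 else N := by
    split_ifs
    exacts [le_max_left _ _, le_max_left _ _, le_rfl]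
  linarith

variable [NormedAlgebra ℚ_[p] K]

theorem Routines.Correct.ensures_diffSolve_approx {T : Routines (FixedPoint p K M) g}
    {MM C : ℕ → ℕ} {I : ℕ} (hT : T.Correct (f.map (reduceSeries p K M)) MM C I)
    (hf : IsUnit (Hzero f)) (hX : IsSolution f G X) (n : ℕ)
    (hM : (p : ℝ) ^ (-M) * p ^ Nat.log p n ≤ 1) :
    (diffSolve T (f.map (reduceSeries p K M)) (fun i => reduceSeries p K M (G i)) n).Ensures
      fun out c => ApproxSolution M X (Hmap f X) n (seriesVec out.1) (seriesMat out.2) ∧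
        c ≤ diffSolveCost g MM C I n := by
  induction n using Nat.strong_induction_on with
  | _ n ih =>
    by_cases hn : n = 0
    · subst hn
      rw [diffSolve, dif_pos rfl, diffSolveCost, dif_pos rfl]
      have hunit : IsUnit (Hzero (f.map (reduceSeries p K M))) := by
        have h1 := hf.map (reduceMod p K M).mapMatrix
        convert h1 using 1
        ext i j
        simp only [Hzero, RingHom.mapMatrix_apply, Matrix.map_apply,
          ← PowerSeries.coeff_zero_eq_constantCoeff_apply, PowerSeries.coeff_map]
      refine (hT.inv _ hunit).bind fun B c ⟨_, hB, hc⟩ => Comp.ensures_pure ⟨?_, by simpa using hc⟩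
      refine approxSolution_zero hX.1 hB (fun i => coeff_seriesVec _ i Nat.one_pos) fun i j => ?_
      exact coeff_seriesMat _ i j Nat.one_pos
    · rw [diffSolveCost, dif_neg hn]
      have hM' := (mul_le_mul_of_nonneg_left (pow_log_mono p (Nat.div_le_self n 2))
        (by positivity)).trans hM
      refine (hT.ensures_diffSolve hn (ih (n / 2) (by omega) hM')
        (fun out hout => hout.constantCoeff_eq_zero hX.1)
        fun out hout => hout.divisionsDefined hX hM).mono fun out c ⟨⟨prev, hprev, hstep⟩, hc⟩ => ?_
      exact ⟨hstep.approxSolution hX hM hn hprev, hc⟩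

end Main

theorem mainTheorem1 :
    ∃ c : ℕ, ∀ (p : ℕ) [Fact p.Prime] (K : Type u) [NormedField K] [IsUltrametricDist K]
      [NormedAlgebra ℚ_[p] K] [FiniteDimensional ℚ_[p] K],
      -- Gauss-Jordan elimination inverts matrices at any precision
      (∀ (g : ℕ) (M : ℝ), 0 < M →
        IsInversion (gaussJordan (R := FixedPoint p K M) (g := g)) (c * g ^ 3)) ∧
      ∀ (n g : ℕ), 1 ≤ n → 1 ≤ g → ∀ (N M : ℝ), 0 < N → M = workingPrecision p n N →
      ∀ (f : Matrix (Fin g) (Fin g) (ringOfInt K)⟦X⟧) (G : Fin g → (ringOfInt K)⟦X⟧)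
        (X : Fin g → K⟦X⟧),
      IsUnit (Hzero f) →
      IsSolution (f.map (PowerSeries.map (ringOfInt K).subtype))
        (fun i => PowerSeries.map (ringOfInt K).subtype (G i)) X →
      (∀ i k, PowerSeries.coeff k (X i) ∈ ringOfInt K) →
      ∀ (T : Routines (FixedPoint p K M) g) (MM : ℕ → ℕ → ℕ) (C I : ℕ → ℕ),
      T.Correct (f.map (PowerSeries.map (reduceMod p K M))) (MM g) C (I g) →
      (diffSolve T (f.map (PowerSeries.map (reduceMod p K M)))
        (fun i => PowerSeries.map (reduceMod p K M) (G i)) n).Ensures fun out cost =>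
          CorrectOutput p M N X (Hmap (f.map (PowerSeries.map (ringOfInt K).subtype)) X) out ∧
          (CostAssumptions g (MM g) C →
            cost ≤ c * (MM g n + C n) + I g ∧
            ∀ (ω A : ℝ) (k : ℕ), 0 ≤ A →
              (∀ a b : ℕ, 1 ≤ a → 1 ≤ b → (MM a b : ℝ) ≤ A * (a : ℝ) ^ ω * MM 1 b) →
              (∀ b : ℕ, 1 ≤ b → (MM 1 b : ℝ) ≤ A * b * (1 + Real.log b) ^ k) →
              (∀ b : ℕ, 1 ≤ b →
                (C b : ℝ) ≤ A * (g : ℝ) ^ ω * b * (1 + Real.log (g * b)) ^ k) →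
              (∀ a : ℕ, 1 ≤ a → (I a : ℝ) ≤ A * (a : ℝ) ^ ω * (1 + Real.log a) ^ k) →
              (cost : ℝ) ≤
                c * (1 + A) ^ 2 * (g : ℝ) ^ ω * n * (1 + Real.log (g * n)) ^ k) := by
  -- The constant 21 covers 6 g ^ 3 for the elimination, 20 * MM n + 2 * C n for the recursion, and
  -- the bound of `cost_le_of_exponent`.
  refine ⟨21, fun p _ K _ _ _ _ => ⟨fun g M hM => ?_, ?_⟩⟩
  · have := isLocalRing_fixedPoint p K hM
    exact isInversion_gaussJordan (by omega)
  · rintro n g hn hg N M hN rfl f G X hf hX hint T MM C I hT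
    have hMN := rpow_neg_workingPrecision_mul_le p n N
    have hM1 := hMN.trans (Real.rpow_le_one_of_one_le_of_nonpos
      (mod_cast (Fact.out : p.Prime).one_lt.le) (neg_nonpos.2 hN.le))
    obtain ⟨Y, rfl⟩ : ∃ Y : Fin g → (ringOfInt K)⟦X⟧,
        X = fun i => PowerSeries.map (ringOfInt K).subtype (Y i) :=
      ⟨fun i => PowerSeries.mk fun k => ⟨_, hint i k⟩, funext fun i => PowerSeries.ext fun k => by
        rw [PowerSeries.coeff_map, PowerSeries.coeff_mk]
        rfl⟩
    have hY := hX.of_map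
    refine (hT.ensures_diffSolve_approx hf hY n hM1).mono fun out cost ⟨hout, hcost⟩ =>
      ⟨?_, fun hCA => ?_⟩
    · rw [Hmap_map _ _ hY.1]
      exact hout.correctOutput hMN
    · have h1 := hCA.diffSolveCost_le (I g) hn
      have h2 : cost ≤ 21 * (MM g n + C n) + I g := by omega
      exact ⟨h2, fun ω A k hA hMM hMM₁ hC hI => cost_le_of_exponent hg hn h2 hA
        (hMM g n hg hn) (hMM₁ n hn) (hC n hn) (hI g hg)⟩
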